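/- Let $\mathcal P=\mathbb C[x]$, let $\mathcal P_m$ be the space of polynomials of degree at most $m$, and let $\mathcal P'$ be the space of linear functionals on $\mathcal P$. For $\mathbf u\in\mathcal P'$ and $\phi\in\mathcal P$ define $\phi\mathbf u$ and $D\mathbf u$ in $\mathcal P'$ by $\langle\phi\mathbf u,p\rangle=\langle\mathbf u,\phi p\rangle$ and $\langle D\mathbf u,p\rangle=-\langle\mathbf u,p'\rangle$, and put $u_n=\langle\mathbf u,x^n\rangle$. A sequence $(P_n)_{n\ge0}$ in $\mathcal P$ is an orthogonal polynomial sequence (OP) with respect to $\mathbf u$ if $\deg P_n=n$ for all $n$ and $\langle\mathbf u,P_mP_n\rangle=\eta_n\delta_{m,n}$ with $\eta_n\ne0$ for all $m,n\ge 0$; $\mathbf u$ is regular if such a sequence exists. A sequence is a monic OP if it consists of monic polynomials and is an OP with respect to some functional. For a monic OP $(P_n)$ put $P_{-1}=0$ and $$P_n^{[k]}=\frac{1}{(n+1)_k}\frac{d^k}{dx^k}P_{n+k}\quad(k,n\ge0),\qquad (\alpha)_k=\alpha(\alpha+1)\cdots(\alpha+k-1),\ (\alpha)_0=1 .$$ For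 $\phi(x)=ax^2+bx+c\in\mathcal P_2$ and $\psi(x)=px+q\in\mathcal P_1$ put $d_n=na+p$ and $e_n=nb+q$ for $n\in\mathbb Z$; the pair $(\phi,\psi)$ is called admissible if $d_n\ne0$ for all $n\ge0$. **Theorem.** Let $\mathbf u\in\mathcal P'$ be regular and let $(P_n)_{n\ge0}$ be its monic OP. The following are equivalent. * (C1) ($\mathbf u$ is classical) There are nonzero $\phi\in\mathcal P_2$, $\psi\in\mathcal P_1$ with $D(\phi\mathbf u)=\psi\mathbf u$. * (C1$'$) There is an admissible pair $(\phi,\psi)$ with $D(\phi\mathbf u)=\psi\mathbf u$. * (C2) (Al-Salam–Chihara) There are $\phi\in\mathcal P_2$ and complex $a_n,b_n,c_n$ ($n\ge0$), with $c_n\neq0$ for $n\ge1$, such that $\phi P_n'=a_nP_{n+1}+b_nP_n+c_nP_{n-1}$ for all $n\ge0$. * (C3) (Hahn) $(P_n^{[k]})_{n\ge0}$ is a monic OP for some $k\ge1$. * (C3$'$) $(P_n^{[k]})_{n\ge0}$ is a monic OP for every $k\ge1$. * (C4) For some $k\ge1$ there are complex $r_n^{[k]},s_n^{[k]}$ such that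 $P_n^{[k-1]}=P_n^{[k]}+r_n^{[k]}P_{n-1}^{[k]}+s_n^{[k]}P_{n-2}^{[k]}$ for all $n\ge2$. * (C4$'$) For every $k\ge1$ there are complex $r_n^{[k]},s_n^{[k]}$ such that this relation holds for all $n\ge2$. * (C5) (Bochner) There are polynomials $\phi,\psi$ and complex $\lambda_n$ ($n\ge0$), with $\lambda_n\ne0$ for $n\ge1$, such that $\phi P_n''+\psi P_n'+\lambda_nP_n=0$ for all $n\ge0$. * (C6) (Maroni) There is an admissible pair $(\phi,\psi)$ such that the formal Stieltjes series $S_{\mathbf u}(z)=-\sum_{n\ge0}u_nz^{-n-1}$ satisfies, as a formal Laurent series in $1/z$, $\phi S_{\mathbf u}'=(\psi-\phi')S_{\mathbf u}+(\psi'-\tfrac12\phi'')u_0$. * (C7) (McCarthy) There are an admissible pair $(\phi,\psi)$ and complex $h_n,t_n$ ($n\ge1$) such that $\phi(P_nP_{n-1})'=h_nP_n^2-(\psi-\phi')P_nP_{n-1}+t_nP_{n-1}^2$ for all $n\ge1$. * (C8) (Rodrigues) There are $\phi\in\mathcal P_2$ and nonzero complex $k_n$ ($n\geq 0$) such that $P_n\mathbf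 u=k_nD^n(\phi^n\mathbf u)$ for all $n\ge0$. Moreover, the polynomials $\phi,\psi$ are the same in all properties where they appear: for given $\phi,\psi\in\mathcal P$, the properties C1, C1$'$, C5, C6, C7 with this pair $(\phi,\psi)$ are equivalent to each other; and for given $\phi\in\mathcal P$, C2 with this $\phi$, C8 with this $\phi$, and C1 with this $\phi$ and some $\psi$ are equivalent. In addition, let $\phi(x)=ax^2+bx+c$ and $\psi(x)=px+q$ be as in C1, and let $$P_{n+1}(x)=(x-\beta_n)P_n(x)-\gamma_nP_{n-1}(x)\quad(n\ge0)$$ be the recurrence relation satisfied by $(P_n)$. Then $\beta_n$ ($n\ge0$) and $\gamma_n$ ($n\ge1$) are uniquely determined and given by $$\beta_0=-\frac qp,\qquad \beta_n=-\frac{d_{-2}\,q+2bn\,d_{n-1}}{d_{2n}d_{2n-2}}\ (n\ge1),$$ $$\gamma_1=-\frac1{d_1}\phi\Big(-\frac qp\Big),\qquad \gamma_n=-\frac{n\,d_{n-2}}{d_{2n-3}d_{2n-1}}\,\phi\Big(-\frac{e_{n-1}}{d_{2n-2}}\Big)\ (n\ge2),$$ and the parameters in the properties above, taken with these $\phi,\psi$,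 are uniquely determined and given by $$a_n=na,\quad b_n=-\tfrac12\psi(\beta_n),\quad \lambda_n=-nd_{n-1},\quad k_n=\prod_{i=0}^{n-1}d_{n+i-1}^{-1}\qquad(n\ge0),$$ $$c_n=-d_{n-1}\gamma_n,\quad h_n=d_{2n-3},\quad t_n=-d_{2n-1}\gamma_n\qquad(n\ge1),$$ $$r_n^{[1]}=\frac{\psi(\beta_n)}{2d_{n-1}},\quad s_n^{[1]}=-\frac{(n-1)a}{d_{n-2}}\gamma_n\qquad(n\ge2).$$ -/

import Mathlib

open Polynomial

noncomputable section

namespace ClassicalOP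

/-- Linear functionals on the space of polynomials. The topological dual for the strict inductive
limit topology is the whole algebraic dual. -/
abbrev Functional := Module.Dual ℂ ℂ[X]

/-- The left multiplication `φ u`, that is `⟨φ u, p⟩ = ⟨u, φ p⟩`. -/
def mulF (φ : ℂ[X]) (u : Functional) : Functional := u ∘ₗ LinearMap.mulLeft ℂ φ

/-- The distributional derivative `D u`, that is `⟨D u, p⟩ = -⟨u, p'⟩`. -/
def derivF (u : Functional) : Functional := -(u ∘ₗ (derivative : ℂ[X] →ₗ[ℂ] ℂ[X]))

/-- `P` is an orthogonal polynomial sequence with respect to `u`: `deg P n = n` for all `n` and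
`⟨u, P m P n⟩ = h n δ_{m n}` with all `h n` nonzero. -/
def IsOP (u : Functional) (P : ℕ → ℂ[X]) : Prop :=
  (∀ n : ℕ, (P n).degree = n) ∧
    ∃ h : ℕ → ℂ, (∀ n, h n ≠ 0) ∧ ∀ m n, u (P m * P n) = if m = n then h n else 0

/-- A functional is regular if there is an orthogonal polynomial sequence for it. -/
def IsRegular (u : Functional) : Prop := ∃ P, IsOP u P

/-- `P` is a monic orthogonal polynomial sequence with respect to `u`. -/
def IsMonicOP (u : Functional) (P : ℕ → ℂ[X]) : Prop := IsOP u P ∧ ∀ n, (P n).Monic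

/-- The polynomial of index `n - 1`, with the convention that the one of index `-1` is zero. -/
def prev (P : ℕ → ℂ[X]) (n : ℕ) : ℂ[X] := if n = 0 then 0 else P (n - 1)

/-- The normalized derivatives `P_n^{[k]} = (d/dx)^k P_{n+k} / (n+1)_k`. -/
def normDeriv (P : ℕ → ℂ[X]) (k n : ℕ) : ℂ[X] :=
  C (((n + 1).ascFactorial k : ℂ)⁻¹) * derivative^[k] (P (n + k))

/-- `d_n = n a + p`, where `a` is the coefficient of `x ^ 2` in `φ` and `p` that of `x` in `ψ`. -/
def dCoef (φ ψ : ℂ[X]) (n : ℤ) : ℂ := n * φ.coeff 2 + ψ.coeff 1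

/-- `e_n = n b + q`, where `b` is the coefficient of `x` in `φ` and `q = ψ(0)`. -/
def eCoef (φ ψ : ℂ[X]) (n : ℤ) : ℂ := n * φ.coeff 1 + ψ.coeff 0

/-- Admissible pairs: `deg φ ≤ 2`, `deg ψ ≤ 1` and `d_n ≠ 0` for every `n ≥ 0`. -/
def IsAdmissible (φ ψ : ℂ[X]) : Prop :=
  φ.degree ≤ 2 ∧ ψ.degree ≤ 1 ∧ ∀ n : ℕ, dCoef φ ψ n ≠ 0

/-- The distributional differential equation `D(φ u) = ψ u`. -/
def Pearson (u : Functional) (φ ψ : ℂ[X]) : Prop := derivF (mulF φ u) = mulF ψ u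

/-- `D(φ u) = ψ u` with nonzero polynomials `φ`, `ψ` of degree at most two and one. -/
def IsClassicalWith (u : Functional) (φ ψ : ℂ[X]) : Prop :=
  φ ≠ 0 ∧ ψ ≠ 0 ∧ φ.degree ≤ 2 ∧ ψ.degree ≤ 1 ∧ Pearson u φ ψ

/-- The three-term recurrence relation with parameters `β`, `γ` (the value `γ 0` is irrelevant). -/
def TTRR (P : ℕ → ℂ[X]) (β γ : ℕ → ℂ) : Prop :=
  P 0 = 1 ∧ ∀ n, P (n + 1) = (X - C (β n)) * P n - C (γ n) * prev P n

/-- The Al-Salam--Chihara structure relation (the value `c 0` is irrelevant). -/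
def StructureRelation (P : ℕ → ℂ[X]) (φ : ℂ[X]) (a b c : ℕ → ℂ) : Prop :=
  (∀ n, 1 ≤ n → c n ≠ 0) ∧
    ∀ n, φ * derivative (P n) = C (a n) * P (n + 1) + C (b n) * P n + C (c n) * prev P n

/-- `P_n^{[k-1]} = P_n^{[k]} + r_n P_{n-1}^{[k]} + s_n P_{n-2}^{[k]}` for `n ≥ 2` (used for
`k ≥ 1`). -/
def DerivRelation (P : ℕ → ℂ[X]) (k : ℕ) (r s : ℕ → ℂ) : Prop :=
  ∀ n, 2 ≤ n → normDeriv P (k - 1) n =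
    normDeriv P k n + C (r n) * normDeriv P k (n - 1) + C (s n) * normDeriv P k (n - 2)

/-- Bochner's second order differential equation. -/
def BochnerODE (P : ℕ → ℂ[X]) (φ ψ : ℂ[X]) (l : ℕ → ℂ) : Prop :=
  (∀ n, 1 ≤ n → l n ≠ 0) ∧
    ∀ n, φ * derivative (derivative (P n)) + ψ * derivative (P n) + C (l n) * P n = 0

/-- Formal Laurent series in `1 / z`: the variable of `LaurentSeries ℂ` stands for `1 / z`.
This is the embedding of polynomials in `z`. -/
def polyAtInfty : ℂ[X] →ₐ[ℂ] LaurentSeries ℂ := aeval (HahnSeries.single (-1 : ℤ) (1 : ℂ))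

/-- The derivative `d/dz = -T² d/dT`, where `T = 1 / z`. -/
def derivZ (f : LaurentSeries ℂ) : LaurentSeries ℂ :=
  -(HahnSeries.single (2 : ℤ) (1 : ℂ) * LaurentSeries.derivative ℂ f)

/-- The formal Stieltjes series `S_u(z) = -∑ u_n / z ^ (n + 1)`. -/
def stieltjes (u : Functional) : LaurentSeries ℂ :=
  -HahnSeries.ofPowerSeries ℤ ℂ (PowerSeries.X * PowerSeries.mk fun n => u (X ^ n))

/-- `φ S_u' = (ψ - φ') S_u + (ψ' - φ''/2) u_0`, as an identity of formal series. -/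
def StieltjesEq (u : Functional) (φ ψ : ℂ[X]) : Prop :=
  polyAtInfty φ * derivZ (stieltjes u) =
    polyAtInfty (ψ - derivative φ) * stieltjes u +
      polyAtInfty ((derivative ψ - C (1 / 2 : ℂ) * derivative (derivative φ)) * C (u 1))

/-- McCarthy's relation (for `n ≥ 1`). -/
def McCarthyRelation (P : ℕ → ℂ[X]) (φ ψ : ℂ[X]) (h t : ℕ → ℂ) : Prop :=
  ∀ n, 1 ≤ n → φ * derivative (P n * P (n - 1)) =
    C (h n) * P n ^ 2 - (ψ - derivative φ) * (P n * P (n - 1)) + C (t n) * P (n - 1) ^ 2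

/-- The distributional Rodrigues formula `P_n u = k_n D^n(φ^n u)`, with all `k_n` nonzero. -/
def RodriguesFormula (u : Functional) (P : ℕ → ℂ[X]) (φ : ℂ[X]) (k : ℕ → ℂ) : Prop :=
  (∀ n, k n ≠ 0) ∧ ∀ n, mulF (P n) u = k n • derivF^[n] (mulF (φ ^ n) u)

end ClassicalOP

end

open ClassicalOP

/-!
Everything rests on the pairing `⟨u, P m P n⟩`: a polynomial of known degree is identified by its
pairings with the `P j`, and it is a combination of three neighbours `P (n + 1)`, `P n`, `P (n - 1)`
as soon as it is orthogonal to the lower ones (`IsMonicOP.three_term`).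

The equation `D(φ u) = ψ u` says that `⟨u, φ q' + ψ q⟩ = 0` for all `q` (`pearson_iff`). With
`q = p' r` it says that Bochner's operator `T p = φ p'' + ψ p'` is symmetric, with Dirichlet form
`-⟨φ u, p' r'⟩`. As `T` does not raise degrees, `P n` is an eigenvector, with eigenvalue
`n d_{n-1}` (`Pearson.bochner_eigen`); this is the differential equation. If some `d_n` vanished,
the Dirichlet form would give `φ P' u = 0`, which is absurd, so classical pairs are admissible.
Conversely, the differential equation makes `⟨u, T p⟩` vanish for all `p`, and every polynomial is
a derivative. Comparing the two highest coefficients below the leading one in the differential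
equation gives `β n` and `γ n`. The Dirichlet form also shows that the derivatives of the `P n` are
orthogonal for `φ u`, which is again classical, for `φ` and `ψ + φ'`; hence all `P^{[k]}` are
orthogonal.

The structure relation is the expansion of `φ P'`, and it returns the equation since it makes
`D(φ u)` vanish at all `P n` with `n ≠ 1`. McCarthy's relation follows from the structure relation
and the recurrence. In the other direction, coprimality of `P n` and `P (n - 1)` extracts
`φ P' = A P + t_n P (n - 1)`, hence an equation `D(φ u) = χ u`; then `χ = ψ`, because the relation
determines its own coefficients (`McCarthyRelation.unique`). Rodrigues' formula holds because
`D^n(φ^n u)` is a polynomial of degree `n` times `u` and annihilates all polynomials of degree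
less than `n`. The identity for the Stieltjes series is `⟨u, φ q' + ψ q⟩ = 0` at `q = x^n`, read
off at `z^(-n-1)`.

If the `P^{[k]}` are orthogonal for one `k ≥ 1`, then differentiating the recurrence relation `k`
times expresses `P^{[k-1]}` through three neighbours in `P^{[k]}` (`derivRelation_of_isMonicOP`).
It remains to return from such a relation to the equation (`DerivRelation.isClassicalWith`). For
each `M ≥ k - 1` the functional `κ` with `D κ = -P (M + 1) u` is `p u` with `p` in the span of
`P M`, `P (M + 1)`, `P (M + 2)` and with a nonzero component along `P M`. The polynomials `f` for
which `D(f u)` is a polynomial multiple of `u` form an ideal. Let `g` be its generator and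
`D(g u) = ψ u`. All the `p` are multiples of `g`, so that modulo `g` each `P M` is a combination
of the next two; hence the tails of `(P n)`, which span the quotient, span a space of dimension at
most two, and `deg g ≤ 2` (`IsMonicOP.natDegree_le_of_dvd`). If `deg ψ ≥ 2`, then the degrees of
the `p` are so low that the same argument yields `deg g ≤ deg g - 1`.
-/

namespace ClassicalOP

variable {u v : Functional} {P : ℕ → ℂ[X]} {φ ψ : ℂ[X]}

/-! ### Orthogonality -/

@[simp] theorem mulF_apply (φ : ℂ[X]) (u : Functional) (p : ℂ[X]) : mulF φ u p = u (φ * p) := rfl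

@[simp] theorem derivF_apply (u : Functional) (p : ℂ[X]) : derivF u p = -u (derivative p) := rfl

theorem map_C_mul (u : Functional) (a : ℂ) (p : ℂ[X]) : u (C a * p) = a * u p := by
  rw [← smul_eq_C_mul, map_smul, smul_eq_mul]

theorem degree_C_mul_le' (a : ℂ) (p : ℂ[X]) : (C a * p).degree ≤ p.degree := by
  rw [← smul_eq_C_mul]; exact degree_smul_le a p

/-- Induction on the degree through a sequence of monic polynomials, one of each degree. -/
theorem degree_induction (hd : ∀ n, (P n).degree = n) (hm : ∀ n, (P n).Monic)
    {M : ℂ[X] → Prop} (h0 : M 0) (n : ℕ)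
    (hs : ∀ m < n, ∀ a q, M q → M (C a * P m + q)) :
    ∀ q : ℂ[X], q.degree < n → M q := by
  induction n with
  | zero =>
    intro q hq
    have : q = 0 := by
      rw [← degree_eq_bot]
      exact Nat.WithBot.lt_zero_iff.mp (by simpa using hq)
    rwa [this]
  | succ n ih =>
    intro q hq
    have h1 : (q - C (q.coeff n) * P n).degree < n := by
      rw [degree_lt_iff_coeff_zero]
      intro k hk
      rcases hk.eq_or_lt with rfl | hk
      · have : (P n).coeff n = 1 := by
          have := hm n
          rwa [Monic, leadingCoeff, natDegree_eq_of_degree_eq_some (hd n)] at this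
        simp [this]
      · have h2 : q.coeff k = 0 := (degree_lt_iff_coeff_zero q (n + 1)).mp hq k hk
        have h3 : (P n).coeff k = 0 := coeff_eq_zero_of_degree_lt (by
          rw [hd n]; exact_mod_cast hk)
        simp [h2, h3]
    have := hs n (Nat.lt_succ_self n) (q.coeff n) _
      (ih (fun m hm' => hs m (hm'.trans (Nat.lt_succ_self n))) _ h1)
    simpa using this

namespace IsMonicOP

variable (hP : IsMonicOP u P)
include hP

theorem degree_eq (n : ℕ) : (P n).degree = n := hP.1.1 n

theorem monic (n : ℕ) : (P n).Monic := hP.2 n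

theorem natDegree_eq (n : ℕ) : (P n).natDegree = n :=
  natDegree_eq_of_degree_eq_some (hP.degree_eq n)

theorem ne_zero (n : ℕ) : P n ≠ 0 := (hP.monic n).ne_zero

theorem coeff_self (n : ℕ) : (P n).coeff n = 1 := by
  have := hP.monic n
  rwa [Monic, leadingCoeff, hP.natDegree_eq] at this

theorem zero_eq_one : P 0 = 1 :=
  eq_one_of_monic_natDegree_zero (hP.monic 0) (hP.natDegree_eq 0)

theorem norm_ne_zero (n : ℕ) : u (P n * P n) ≠ 0 := by
  obtain ⟨h, h0, h1⟩ := hP.1.2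
  simpa [h1] using h0 n

theorem apply_mul_ne {m n : ℕ} (hmn : m ≠ n) : u (P m * P n) = 0 := by
  obtain ⟨h, h0, h1⟩ := hP.1.2
  simp [h1, hmn]

theorem induction {M : ℂ[X] → Prop} (h0 : M 0)
    (hs : ∀ m a q, M q → M (C a * P m + q)) (q : ℂ[X]) : M q :=
  degree_induction hP.degree_eq hP.monic h0 (q.natDegree + 1) (fun m _ => hs m) q
    (by exact_mod_cast degree_le_natDegree.trans_lt (by exact_mod_cast Nat.lt_succ_self _))

theorem apply_mul_of_degree_lt {n : ℕ} {q : ℂ[X]} (hq : q.degree < n) : u (P n * q) = 0 := by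
  refine degree_induction hP.degree_eq hP.monic (M := fun q => u (P n * q) = 0) (by simp) n
    (fun m hm a q h => ?_) q hq
  rw [mul_add, map_add, h, mul_left_comm, map_C_mul, hP.apply_mul_ne hm.ne']
  simp

theorem apply_mul_of_degree_le {n : ℕ} {q : ℂ[X]} (hq : q.degree ≤ n) :
    u (P n * q) = q.coeff n * u (P n * P n) := by
  have h : (q - C (q.coeff n) * P n).degree < n := by
    rw [degree_lt_iff_coeff_zero]
    intro k hk
    rcases hk.eq_or_lt with rfl | hk
    · simp [hP.coeff_self]
    · have h2 : q.coeff k = 0 := coeff_eq_zero_of_degree_lt (hq.trans_lt (by exact_mod_cast hk))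
      have h3 : (P n).coeff k = 0 := coeff_eq_zero_of_degree_lt (by
          rw [hP.degree_eq n]; exact_mod_cast hk)
      simp [h2, h3]
  have := hP.apply_mul_of_degree_lt h
  rw [mul_sub, map_sub, mul_left_comm, map_C_mul] at this
  linear_combination this

theorem functional_ext {v w : Functional} (h : ∀ n, v (P n) = w (P n)) : v = w := by
  refine LinearMap.ext fun q => ?_
  refine hP.induction (M := fun q => v q = w q) (by simp) (fun m a q hq => ?_) q
  rw [map_add, map_add, map_C_mul, map_C_mul, h, hq]

theorem eq_zero_of_apply_mul {p : ℂ[X]} (h : ∀ j ≤ p.natDegree, u (P j * p) = 0) : p = 0 := by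
  have h1 := h p.natDegree le_rfl
  rw [hP.apply_mul_of_degree_le degree_le_natDegree] at h1
  simpa [hP.norm_ne_zero] using h1

theorem eq_zero_of_mulF {p : ℂ[X]} (h : mulF p u = 0) : p = 0 :=
  hP.eq_zero_of_apply_mul fun j _ => by
    have := congrArg (fun v : Functional => v (P j)) h
    simpa [mul_comm] using this

theorem mulF_injective {p q : ℂ[X]} (h : mulF p u = mulF q u) : p = q := by
  rw [← sub_eq_zero]
  apply hP.eq_zero_of_mulF
  refine LinearMap.ext fun r => ?_
  have := congrArg (fun v : Functional => v r) h
  simp only [mulF_apply] at this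
  simp [sub_mul, this]

/-- A polynomial of degree at most `n + 1` that is orthogonal to all `P j` with `j + 1 < n` is a
combination of `P (n + 1)`, `P n`, `P (n - 1)`; the coefficients are Fourier coefficients.
For `n = 0` the last quotient is `0 / 0 = 0`, and `prev P 0 = 0`. -/
theorem three_term {n : ℕ} {p : ℂ[X]} (hp : p.degree ≤ ((n + 1 : ℕ) : WithBot ℕ))
    (h : ∀ j, j + 1 < n → u (P j * p) = 0) :
    p = C (p.coeff (n + 1)) * P (n + 1) + C (u (P n * p) / u (P n * P n)) * P n +
      C (u (prev P n * p) / u (prev P n * prev P n)) * prev P n := by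
  rw [← sub_eq_zero]
  have hpn : (prev P n).degree ≤ n := by
    unfold prev
    split_ifs with h0
    · simp
    · rw [hP.degree_eq]; exact_mod_cast Nat.sub_le n 1
  refine hP.eq_zero_of_apply_mul fun j hj => ?_
  have hj : j ≤ n + 1 := by
    refine hj.trans (natDegree_le_of_degree_le ?_)
    refine (degree_sub_le _ _).trans (max_le hp ((degree_add_le _ _).trans (max_le
      ((degree_add_le _ _).trans (max_le ?_ ?_)) ?_)))
    · exact (degree_C_mul_le' _ _).trans (hP.degree_eq _).le
    · exact (degree_C_mul_le' _ _).trans ((hP.degree_eq _).le.trans (by exact_mod_cast n.le_succ))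
    · exact (degree_C_mul_le' _ _).trans (hpn.trans (by exact_mod_cast n.le_succ))
  have key : ∀ i, i ≤ n + 1 → u (P i * prev P n) =
      if i + 1 = n then u (prev P n * prev P n) else 0 := by
    intro i _
    unfold prev
    rcases n with _ | n
    · simp
    · simp only [Nat.add_eq_zero_iff, one_ne_zero, and_false, if_false, Nat.add_sub_cancel,
        add_left_inj]
      split_ifs with h1
      · rw [h1]
      · exact hP.apply_mul_ne h1
  simp only [mul_sub, mul_add, map_sub, map_add, mul_left_comm (P j), map_C_mul, key j hj]
  rcases hj.eq_or_lt with rfl | hj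
  · rw [hP.apply_mul_of_degree_le hp, hP.apply_mul_ne (show n + 1 ≠ n by simp), if_neg (by omega)]
    simp
  rcases (Nat.lt_succ_iff.mp hj).eq_or_lt with rfl | hj
  · rw [hP.apply_mul_ne (by simp)]
    simp [hP.norm_ne_zero]
  rw [hP.apply_mul_ne (show j ≠ n + 1 by omega), hP.apply_mul_ne hj.ne]
  split_ifs with h2
  · subst h2
    simp [prev, hP.norm_ne_zero]
  · rw [h j (by omega)]; simp

theorem coeffs_unique {n : ℕ} {a b c a' b' c' : ℂ}
    (h : C a * P (n + 1) + C b * P n + C c * prev P n =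
      C a' * P (n + 1) + C b' * P n + C c' * prev P n) :
    a = a' ∧ b = b' ∧ (1 ≤ n → c = c') := by
  have e : ∀ j, a * u (P j * P (n + 1)) + b * u (P j * P n) + c * u (P j * prev P n) =
      a' * u (P j * P (n + 1)) + b' * u (P j * P n) + c' * u (P j * prev P n) := by
    intro j
    have := congrArg (fun p => u (P j * p)) h
    simpa only [mul_add, map_add, mul_left_comm (P j), map_C_mul] using this
  have q0 : ∀ j, n ≤ j → u (P j * prev P n) = 0 := by
    intro j hj
    unfold prev
    split_ifs with h0
    · simp
    · exact hP.apply_mul_ne (by omega)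
  refine ⟨?_, ?_, fun hn => ?_⟩
  · have := e (n + 1)
    rw [q0 _ (by omega), hP.apply_mul_ne (show n + 1 ≠ n by simp)] at this
    simpa [hP.norm_ne_zero] using this
  · have := e n
    rw [q0 _ le_rfl, hP.apply_mul_ne (show n ≠ n + 1 by simp)] at this
    simpa [hP.norm_ne_zero] using this
  · have := e (n - 1)
    have h1 : prev P n = P (n - 1) := if_neg (by omega)
    rw [h1, hP.apply_mul_ne (show n - 1 ≠ n by omega),
      hP.apply_mul_ne (show n - 1 ≠ n + 1 by omega)] at this
    simpa [hP.norm_ne_zero] using this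

theorem degree_X_mul (n : ℕ) : (X * P n).degree = ((n + 1 : ℕ) : WithBot ℕ) := by
  rw [degree_mul, hP.degree_eq, degree_X]; push_cast; ring

theorem exists_ttrr : ∃ β γ : ℕ → ℂ, TTRR P β γ := by
  refine ⟨fun n => u (P n * (X * P n)) / u (P n * P n),
    fun n => u (prev P n * (X * P n)) / u (prev P n * prev P n), hP.zero_eq_one, fun n => ?_⟩
  have h := hP.three_term (n := n) (p := X * P n) (hP.degree_X_mul n).le (fun j hj => by
    rw [← mul_assoc, mul_comm]
    apply hP.apply_mul_of_degree_lt
    rw [mul_comm, hP.degree_X_mul]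
    exact_mod_cast hj)
  have h1 : (X * P n).coeff (n + 1) = 1 := by rw [coeff_X_mul, hP.coeff_self]
  rw [h1, C_1, one_mul] at h
  linear_combination -h

omit hP in
theorem _root_.ClassicalOP.TTRR.congr {β γ β' γ' : ℕ → ℂ} (h : TTRR P β γ) (hβ : ∀ n, β n = β' n)
    (hγ : ∀ n, 1 ≤ n → γ n = γ' n) : TTRR P β' γ' := by
  refine ⟨h.1, fun n => ?_⟩
  rw [h.2 n, hβ]
  rcases n with _ | n
  · simp [prev]
  · rw [hγ _ (by omega)]

variable {β γ : ℕ → ℂ} (hT : TTRR P β γ)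
include hT

omit hP in
theorem _root_.ClassicalOP.TTRR.X_mul (n : ℕ) : X * P n = P (n + 1) + C (β n) * P n + C (γ n) * prev P n := by
  rw [hT.2 n]; ring

theorem apply_X_mul (n : ℕ) : u (P n * (X * P n)) = β n * u (P n * P n) := by
  have h0 : u (P n * prev P n) = 0 := by
    unfold prev
    split_ifs with h0
    · simp
    · exact hP.apply_mul_ne (by omega)
  rw [hT.X_mul, mul_add, mul_add, map_add, map_add, mul_left_comm, map_C_mul,
    mul_left_comm, map_C_mul, h0, hP.apply_mul_ne (by simp)]
  simp

theorem norm_succ (n : ℕ) : u (P (n + 1) * P (n + 1)) = γ (n + 1) * u (P n * P n) := by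
  have h1 : u (P n * (X * P (n + 1))) = γ (n + 1) * u (P n * P n) := by
    rw [hT.X_mul, mul_add, mul_add, map_add, map_add, mul_left_comm, map_C_mul,
      mul_left_comm, map_C_mul, hP.apply_mul_ne (show n ≠ n + 1 + 1 by omega),
      hP.apply_mul_ne (show n ≠ n + 1 by omega)]
    simp [prev]
  rw [← h1, show P n * (X * P (n + 1)) = P (n + 1) * (X * P n) by ring,
    hP.apply_mul_of_degree_le (hP.degree_X_mul n).le, coeff_X_mul, hP.coeff_self, one_mul]

theorem gamma_ne_zero {n : ℕ} (hn : 1 ≤ n) : γ n ≠ 0 := by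
  obtain ⟨n, rfl⟩ := Nat.exists_eq_add_of_le' hn
  intro h
  have := hP.norm_succ hT n
  rw [h, zero_mul] at this
  exact hP.norm_ne_zero _ this

omit hT

theorem isCoprime (n : ℕ) : IsCoprime (P (n + 1)) (P n) := by
  obtain ⟨β, γ, hT⟩ := hP.exists_ttrr
  induction n with
  | zero => rw [hP.zero_eq_one]; exact isCoprime_one_right
  | succ n ih =>
    have hg : IsUnit (C (γ (n + 1))) := (hP.gamma_ne_zero hT (by omega)).isUnit.map C
    rw [hT.2 (n + 1), sub_eq_add_neg, add_comm, IsCoprime.add_mul_right_left_iff,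
      IsCoprime.neg_left_iff, isCoprime_mul_unit_left_left hg]
    simpa [prev] using ih.symm

end IsMonicOP

/-! ### The distributional equation and Bochner's operator -/

theorem derivative_surjective :
    Function.Surjective (derivative : ℂ[X] →ₗ[ℂ] ℂ[X]) := by
  intro q
  induction q using Polynomial.induction_on' with
  | add p q hp hq =>
    obtain ⟨⟨a, rfl⟩, ⟨b, rfl⟩⟩ := And.intro hp hq
    exact ⟨a + b, derivative_add⟩
  | monomial n a =>
    refine ⟨monomial (n + 1) (a / (n + 1)), ?_⟩
    have : (n + 1 : ℂ) ≠ 0 := Nat.cast_add_one_ne_zero n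
    rw [derivative_monomial]
    push_cast
    rw [div_mul_cancel₀ _ this]

theorem pearson_iff : Pearson u φ ψ ↔ ∀ q, u (φ * derivative q + ψ * q) = 0 := by
  simp only [Pearson, LinearMap.ext_iff, derivF_apply, mulF_apply, map_add]
  exact forall_congr' fun q => by rw [neg_eq_iff_add_eq_zero]

/-- The degrees of `φ` and `ψ` do not matter for the constant coefficient; for the others see
`coeff_succ_pearson`. -/
theorem coeff_zero_pearson (q : ℂ[X]) : (φ * derivative q + ψ * q).coeff 0 =
    ψ.coeff 0 * q.coeff 0 + φ.coeff 0 * q.coeff 1 := by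
  simp [mul_coeff_zero, coeff_derivative]; ring

section Degrees

variable (hφ : φ.degree ≤ 2) (hψ : ψ.degree ≤ 1)
include hφ hψ

theorem coeff_succ_pearson (q : ℂ[X]) (m : ℕ) :
    (φ * derivative q + ψ * q).coeff (m + 1) = dCoef φ ψ m * q.coeff m +
      eCoef φ ψ (m + 1) * q.coeff (m + 1) + (m + 2) * φ.coeff 0 * q.coeff (m + 2) := by
  have h1 : φ * derivative q + ψ * q = C (φ.coeff 2) * (derivative q * X ^ 2) +
      C (φ.coeff 1) * (derivative q * X) + C (φ.coeff 0) * derivative q +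
      C (ψ.coeff 1) * (q * X) + C (ψ.coeff 0) * q := by
    conv_lhs => rw [eq_quadratic_of_degree_le_two hφ, eq_X_add_C_of_degree_le_one hψ]
    ring
  rw [h1]
  simp only [coeff_add, coeff_C_mul, coeff_mul_X, coeff_derivative, dCoef, eCoef]
  rcases m with _ | m
  · rw [coeff_mul_X_pow']
    simp
    ring
  · rw [show m + 1 + 1 = m + 2 from rfl, coeff_mul_X_pow, coeff_derivative]
    push_cast
    ring

theorem coeff_bochner (p : ℂ[X]) (m : ℕ) :
    (φ * derivative (derivative p) + ψ * derivative p).coeff m =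
      m * dCoef φ ψ ((m : ℤ) - 1) * p.coeff m + (m + 1) * eCoef φ ψ m * p.coeff (m + 1) +
        (m + 2) * (m + 1) * φ.coeff 0 * p.coeff (m + 2) := by
  rcases m with _ | m
  · rw [coeff_zero_pearson]
    simp [coeff_derivative, eCoef]
    ring
  · rw [coeff_succ_pearson hφ hψ]
    simp only [coeff_derivative]
    push_cast
    simp only [add_sub_cancel_right]
    ring

theorem degree_pearson_le {q : ℂ[X]} {n : ℕ} (hq : q.degree ≤ n) :
    (φ * derivative q + ψ * q).degree ≤ ((n + 1 : ℕ) : WithBot ℕ) := by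
  rw [degree_le_iff_coeff_zero] at hq ⊢
  intro m hm
  have hm : n + 1 < m := by exact_mod_cast hm
  obtain ⟨m, rfl⟩ : ∃ k, m = k + 1 := ⟨m - 1, by omega⟩
  rw [coeff_succ_pearson hφ hψ, hq m (by exact_mod_cast (by omega)),
    hq (m + 1) (by exact_mod_cast (by omega)), hq (m + 2) (by exact_mod_cast (by omega))]
  simp

theorem coeff_pearson_of_degree_le {q : ℂ[X]} {n : ℕ} (hq : q.degree ≤ n) :
    (φ * derivative q + ψ * q).coeff (n + 1) = dCoef φ ψ n * q.coeff n := by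
  rw [degree_le_iff_coeff_zero] at hq
  rw [coeff_succ_pearson hφ hψ,
    hq (n + 1) (by exact_mod_cast (by omega)), hq (n + 2) (by exact_mod_cast (by omega))]
  simp

theorem degree_bochner_le {p : ℂ[X]} {n : ℕ} (hp : p.degree ≤ n) :
    (φ * derivative (derivative p) + ψ * derivative p).degree ≤ n := by
  rw [degree_le_iff_coeff_zero] at hp ⊢
  intro m hm
  have hm : n < m := by exact_mod_cast hm
  rw [coeff_bochner hφ hψ, hp m (by exact_mod_cast (by omega)),
    hp (m + 1) (by exact_mod_cast (by omega)), hp (m + 2) (by exact_mod_cast (by omega))]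
  simp

end Degrees

/-- Bochner's operator is symmetric with respect to `u`, with Dirichlet form `⟨φ u, p' q'⟩`. -/
theorem Pearson.apply_mul_bochner (h : Pearson u φ ψ) (p q : ℂ[X]) :
    u (q * (φ * derivative (derivative p) + ψ * derivative p)) =
      -u (φ * (derivative p * derivative q)) := by
  have h1 := pearson_iff.mp h (derivative p * q)
  have h2 : q * (φ * derivative (derivative p) + ψ * derivative p) +
      φ * (derivative p * derivative q) =
      φ * derivative (derivative p * q) + ψ * (derivative p * q) := by
    rw [derivative_mul]; ring
  rw [eq_neg_iff_add_eq_zero, ← map_add, h2, h1]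

theorem Pearson.apply_mul_derivative (h : Pearson u φ ψ) (p q : ℂ[X]) :
    u (q * (φ * derivative p)) = -u (p * (φ * derivative q + ψ * q)) := by
  have h1 := pearson_iff.mp h (p * q)
  have h2 : q * (φ * derivative p) + p * (φ * derivative q + ψ * q) =
      φ * derivative (p * q) + ψ * (p * q) := by
    rw [derivative_mul]; ring
  rw [eq_neg_iff_add_eq_zero, ← map_add, h2, h1]

section

variable (hP : IsMonicOP u P)
include hP

theorem Pearson.bochner_eigen (h : Pearson u φ ψ) (hφ : φ.degree ≤ 2) (hψ : ψ.degree ≤ 1)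
    (n : ℕ) : φ * derivative (derivative (P n)) + ψ * derivative (P n) =
      C (n * dCoef φ ψ ((n : ℤ) - 1)) * P n := by
  have hd := degree_bochner_le hφ hψ (hP.degree_eq n).le
  rw [← sub_eq_zero]
  refine hP.eq_zero_of_apply_mul fun j hj => ?_
  have hj : j ≤ n := hj.trans (natDegree_le_of_degree_le ((degree_sub_le _ _).trans
    (max_le hd ((degree_C_mul_le' _ _).trans (hP.degree_eq n).le))))
  rw [mul_sub, map_sub, mul_left_comm, map_C_mul]
  rcases hj.eq_or_lt with rfl | hj
  · have h1 : (P j).coeff (j + 1) = 0 := coeff_eq_zero_of_natDegree_lt (by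
      rw [hP.natDegree_eq]; omega)
    have h2 : (P j).coeff (j + 2) = 0 := coeff_eq_zero_of_natDegree_lt (by
      rw [hP.natDegree_eq]; omega)
    rw [hP.apply_mul_of_degree_le hd, coeff_bochner hφ hψ, hP.coeff_self, h1, h2]
    ring
  · rw [h.apply_mul_bochner, hP.apply_mul_ne hj.ne, mul_comm (derivative (P n)),
      ← h.apply_mul_bochner, hP.apply_mul_of_degree_lt]
    · simp
    · exact (degree_bochner_le hφ hψ (hP.degree_eq j).le).trans_lt (by exact_mod_cast hj)

theorem derivative_ne_zero_of_one_le {n : ℕ} (hn : 1 ≤ n) :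
    derivative (P n) ≠ 0 := by
  intro h
  have := derivative_eq_zero.mp h
  rw [hP.natDegree_eq] at this
  omega

/-- If `d_n = 0`, then `P (n + 1)` is in the kernel of Bochner's operator, and its Dirichlet form
gives `φ P' u = 0`. -/
theorem Pearson.dCoef_ne_zero (h : Pearson u φ ψ) (hφ : φ.degree ≤ 2) (hψ : ψ.degree ≤ 1)
    (h0 : φ ≠ 0) (n : ℕ) : dCoef φ ψ n ≠ 0 := by
  intro hd
  have h1 := h.bochner_eigen hP hφ hψ (n + 1)
  have h2 : φ * derivative (P (n + 1)) = 0 := by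
    refine hP.eq_zero_of_apply_mul fun j _ => ?_
    obtain ⟨q, hq⟩ := derivative_surjective (P j)
    have h3 := h.apply_mul_bochner (P (n + 1)) q
    rw [h1, hq] at h3
    push_cast at h3
    rw [add_sub_cancel_right, hd] at h3
    simp only [mul_zero, map_zero, zero_mul] at h3
    rw [show P j * (φ * derivative (P (n + 1))) = φ * (derivative (P (n + 1)) * P j) by ring]
    rw [← neg_eq_zero, ← h3]
  rcases mul_eq_zero.mp h2 with h2 | h2
  · exact h0 h2
  · exact derivative_ne_zero_of_one_le hP (by omega) h2

theorem Pearson.left_ne_zero (h : Pearson u φ ψ) (hψ : ψ ≠ 0) : φ ≠ 0 := by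
  rintro rfl
  refine hψ (hP.eq_zero_of_apply_mul fun j _ => ?_)
  simpa [mul_comm] using pearson_iff.mp h (P j)

theorem Pearson.right_ne_zero (h : Pearson u φ ψ) (hφ : φ ≠ 0) : ψ ≠ 0 := by
  rintro rfl
  refine hφ (hP.eq_zero_of_apply_mul fun j _ => ?_)
  obtain ⟨q, hq⟩ := derivative_surjective (P j)
  simpa [hq, mul_comm] using pearson_iff.mp h q

theorem isClassicalWith_iff_admissible :
    IsClassicalWith u φ ψ ↔ IsAdmissible φ ψ ∧ Pearson u φ ψ := by
  constructor
  · rintro ⟨h1, h2, h3, h4, h5⟩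
    exact ⟨⟨h3, h4, h5.dCoef_ne_zero hP h3 h4 h1⟩, h5⟩
  · rintro ⟨⟨h3, h4, h6⟩, h5⟩
    have h2 : ψ ≠ 0 := by
      rintro rfl
      simpa [dCoef] using h6 0
    exact ⟨h5.left_ne_zero hP h2, h2, h3, h4, h5⟩

theorem IsClassicalWith.dCoef_ne_zero (h : IsClassicalWith u φ ψ) {n : ℤ} (hn : 0 ≤ n) :
    dCoef φ ψ n ≠ 0 := by
  obtain ⟨n, rfl⟩ := Int.eq_ofNat_of_zero_le hn
  exact ((isClassicalWith_iff_admissible hP).mp h).1.2.2 n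

theorem IsClassicalWith.bochnerODE_iff (h : IsClassicalWith u φ ψ) (l : ℕ → ℂ) :
    BochnerODE P φ ψ l ↔ ∀ n : ℕ, l n = -n * dCoef φ ψ ((n : ℤ) - 1) := by
  constructor
  · rintro ⟨-, h2⟩ n
    have h3 := h2 n
    rw [h.2.2.2.2.bochner_eigen hP h.2.2.1 h.2.2.2.1, ← add_mul, ← C_add, mul_eq_zero,
      or_iff_left (hP.ne_zero n), C_eq_zero] at h3
    linear_combination h3
  · intro hl
    refine ⟨fun n hn => ?_, fun n => ?_⟩
    · rw [hl]
      refine mul_ne_zero ?_ (h.dCoef_ne_zero hP (by omega))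
      simp; omega
    · rw [h.2.2.2.2.bochner_eigen hP h.2.2.1 h.2.2.2.1, hl, ← add_mul, ← C_add]
      simp

/-- The cases `n = 1` and `n = 2` of the differential equation bound the degrees of `ψ` and `φ`. -/
theorem BochnerODE.isClassicalWith {l : ℕ → ℂ} (h : BochnerODE P φ ψ l) :
    IsClassicalWith u φ ψ := by
  obtain ⟨hl, h⟩ := h
  have h1 : ψ = C (-l 1) * P 1 := by
    have h1 := h 1
    have h2 : derivative (P 1) = 1 := by
      rw [eq_X_add_C_of_degree_le_one (hP.degree_eq 1).le, hP.coeff_self]; simp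
    rw [h2] at h1
    simp only [derivative_one, mul_zero, mul_one, zero_add] at h1
    rw [C_neg]
    linear_combination h1
  have hψ : ψ.degree ≤ 1 := by
    rw [h1]; exact (degree_C_mul_le' _ _).trans (hP.degree_eq 1).le
  have hψ0 : ψ ≠ 0 := by
    rw [h1]
    exact mul_ne_zero (by simpa using hl 1 le_rfl) (hP.ne_zero 1)
  have hφ : φ.degree ≤ 2 := by
    have h2 := h 2
    have h3 : derivative (derivative (P 2)) = C 2 := by
      rw [eq_quadratic_of_degree_le_two (hP.degree_eq 2).le, hP.coeff_self]
      simp only [derivative_add, derivative_C_mul, derivative_X_pow, derivative_C, derivative_X,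
        derivative_one, derivative_zero]
      norm_num
    have h4 : φ = C (-(1 / 2)) * (ψ * derivative (P 2) + C (l 2) * P 2) := by
      rw [h3] at h2
      have h5 : φ * (C 2 * C (1 / 2)) = φ := by rw [← C_mul]; simp
      rw [C_neg]
      linear_combination C (1 / 2) * h2 - h5
    rw [h4]
    refine (degree_C_mul_le' _ _).trans ((degree_add_le _ _).trans (max_le ?_
      ((degree_C_mul_le' _ _).trans (hP.degree_eq 2).le)))
    refine (degree_mul_le _ _).trans ?_
    have h6 : (derivative (P 2)).degree ≤ 1 := by
      have := degree_derivative_lt (hP.ne_zero 2)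
      rw [hP.degree_eq] at this
      exact Order.le_of_lt_succ this
    exact (add_le_add hψ h6).trans (by norm_num)
  have hp : Pearson u φ ψ := by
    rw [pearson_iff]
    intro q
    obtain ⟨p, rfl⟩ := derivative_surjective q
    have : ∀ p, u (φ * derivative (derivative p) + ψ * derivative p) = 0 := by
      intro p
      refine hP.induction (M := fun p => u (φ * derivative (derivative p) + ψ * derivative p) = 0)
        (by simp) (fun m a q hq => ?_) p
      have h7 : φ * derivative (derivative (C a * P m + q)) + ψ * derivative (C a * P m + q) =
          C (a * -l m) * P m + (φ * derivative (derivative q) + ψ * derivative q) := by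
        simp only [derivative_add, derivative_C_mul, C_mul, C_neg]
        linear_combination C a * h m
      rw [h7, map_add, hq, map_C_mul]
      rcases Nat.eq_zero_or_pos m with rfl | hm
      · have h8 := h 0
        rw [hP.zero_eq_one] at h8
        simp only [derivative_one, mul_zero, derivative_zero, zero_add, mul_one, C_eq_zero] at h8
        rw [h8]; simp
      · have h9 := hP.apply_mul_ne hm.ne'
        rw [hP.zero_eq_one, mul_one] at h9
        rw [h9]; simp
    exact this p
  exact ⟨hp.left_ne_zero hP hψ0, hψ0, hφ, hψ, hp⟩

end

section

variable (hP : IsMonicOP u P) (h : IsClassicalWith u φ ψ)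
include hP h

/-! ### The recurrence coefficients -/

theorem IsClassicalWith.coeff_pred (n : ℕ) :
    dCoef φ ψ (2 * (n : ℤ)) * (P (n + 1)).coeff n = (n + 1) * eCoef φ ψ n := by
  have h1 := congrArg (fun p => coeff p n)
    (h.2.2.2.2.bochner_eigen hP h.2.2.1 h.2.2.2.1 (n + 1))
  have h2 : (P (n + 1)).coeff (n + 2) = 0 := coeff_eq_zero_of_natDegree_lt (by
    rw [hP.natDegree_eq]; omega)
  simp only [coeff_bochner h.2.2.1 h.2.2.2.1, coeff_C_mul, hP.coeff_self, h2] at h1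
  simp only [dCoef] at h1 ⊢
  push_cast at h1 ⊢
  linear_combination -h1

theorem IsClassicalWith.coeff_pred_pred (n : ℕ) :
    2 * dCoef φ ψ (2 * (n : ℤ) + 1) * (P (n + 2)).coeff n =
      (n + 1) * (eCoef φ ψ n * (P (n + 2)).coeff (n + 1) + (n + 2) * φ.coeff 0) := by
  have h1 := congrArg (fun p => coeff p n)
    (h.2.2.2.2.bochner_eigen hP h.2.2.1 h.2.2.2.1 (n + 2))
  simp only [coeff_bochner h.2.2.1 h.2.2.2.1, coeff_C_mul, hP.coeff_self] at h1
  simp only [dCoef] at h1 ⊢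
  push_cast at h1 ⊢
  linear_combination -h1

variable {β γ : ℕ → ℂ} (hT : TTRR P β γ)
include hT

omit h in
omit hP in
theorem TTRR.beta_zero : β 0 = -(P 1).coeff 0 := by
  have := hT.2 0
  rw [hT.1] at this
  simp only [zero_add, prev, mul_one, if_true, mul_zero, sub_zero] at this
  rw [this]; simp

omit h in
theorem TTRR.beta_succ (n : ℕ) :
    β (n + 1) = (P (n + 1)).coeff n - (P (n + 2)).coeff (n + 1) := by
  have h1 := congrArg (fun p => coeff p (n + 1)) (hT.2 (n + 1))
  have h2 : (P n).coeff (n + 1) = 0 := coeff_eq_zero_of_natDegree_lt (by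
    rw [hP.natDegree_eq]; omega)
  simp only [sub_mul, coeff_sub, coeff_X_mul, coeff_C_mul, hP.coeff_self, prev,
    Nat.add_sub_cancel, if_neg (Nat.succ_ne_zero n), h2] at h1
  linear_combination h1

omit h in
theorem TTRR.gamma_one : γ 1 = -(P 2).coeff 0 - β 1 * (P 1).coeff 0 := by
  have h1 := congrArg (fun p => coeff p 0) (hT.2 1)
  simp only [sub_mul, coeff_sub, mul_coeff_zero, coeff_X_zero, coeff_C_zero, prev,
    if_neg one_ne_zero, Nat.sub_self, hP.coeff_self] at h1
  linear_combination h1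

omit h in
theorem TTRR.gamma_add_two (n : ℕ) : γ (n + 2) =
    (P (n + 2)).coeff n - (P (n + 3)).coeff (n + 1) - β (n + 2) * (P (n + 2)).coeff (n + 1) := by
  have h1 := congrArg (fun p => coeff p (n + 1)) (hT.2 (n + 2))
  simp only [sub_mul, coeff_sub, coeff_X_mul, coeff_C_mul, prev,
    if_neg (Nat.succ_ne_zero (n + 1)), show n + 2 - 1 = n + 1 from rfl, hP.coeff_self] at h1
  linear_combination h1

/-- The coefficients of `x ^ (n - 1)` in Bochner's equation, eliminated between neighbours. -/
theorem IsClassicalWith.beta_recurrence (n : ℕ) : dCoef φ ψ (2 * (n : ℤ) + 2) * β (n + 1) =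
    dCoef φ ψ (2 * (n : ℤ) - 2) * β n - 2 * φ.coeff 1 := by
  rw [hT.beta_succ hP]
  have h1 := h.coeff_pred hP n
  have h2 := h.coeff_pred hP (n + 1)
  rcases n with _ | n
  · rw [hT.beta_zero]
    simp only [dCoef, eCoef] at h1 h2 ⊢
    push_cast at h1 h2 ⊢
    linear_combination 2 * h1 - h2
  · have h3 := h.coeff_pred hP n
    rw [hT.beta_succ hP]
    simp only [dCoef, eCoef] at h1 h2 h3 ⊢
    push_cast at h1 h2 h3 ⊢
    linear_combination 2 * h1 - h2 - h3

theorem IsClassicalWith.beta_zero : β 0 = -(ψ.coeff 0 / ψ.coeff 1) := by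
  have h0 : dCoef φ ψ 0 ≠ 0 := h.dCoef_ne_zero hP le_rfl
  have h1 := h.coeff_pred hP 0
  rw [hT.beta_zero]
  simp only [dCoef, eCoef] at h0 h1
  push_cast at h0 h1
  simp only [zero_mul, zero_add, one_mul] at h0 h1
  rw [neg_inj, eq_div_iff h0]
  linear_combination h1

theorem IsClassicalWith.beta_eq {n : ℕ} (hn : 1 ≤ n) : β n =
    -((dCoef φ ψ (-2) * ψ.coeff 0 + 2 * φ.coeff 1 * n * dCoef φ ψ ((n : ℤ) - 1)) /
      (dCoef φ ψ (2 * (n : ℤ)) * dCoef φ ψ (2 * (n : ℤ) - 2))) := by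
  obtain ⟨n, rfl⟩ := Nat.exists_eq_add_of_le' hn
  have h0 : dCoef φ ψ (2 * ((n + 1 : ℕ) : ℤ)) ≠ 0 := h.dCoef_ne_zero hP (by omega)
  have h0' : dCoef φ ψ (2 * ((n + 1 : ℕ) : ℤ) - 2) ≠ 0 := h.dCoef_ne_zero hP (by omega)
  have h1 := h.coeff_pred hP n
  have h2 := h.coeff_pred hP (n + 1)
  rw [hT.beta_succ hP, ← neg_div, eq_div_iff (mul_ne_zero h0 h0')]
  simp only [dCoef, eCoef] at h1 h2 ⊢
  push_cast at h1 h2 ⊢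
  linear_combination ((2 * (n + 1)) * φ.coeff 2 + ψ.coeff 1) * h1 -
    (2 * n * φ.coeff 2 + ψ.coeff 1) * h2

omit hP h hT in
theorem eval_quadratic (hφ : φ.degree ≤ 2) (x : ℂ) :
    φ.eval x = φ.coeff 2 * x ^ 2 + φ.coeff 1 * x + φ.coeff 0 := by
  conv_lhs => rw [eq_quadratic_of_degree_le_two hφ]
  simp

omit hP h hT in
theorem eval_linear (hψ : ψ.degree ≤ 1) (x : ℂ) :
    ψ.eval x = ψ.coeff 1 * x + ψ.coeff 0 := by
  conv_lhs => rw [eq_X_add_C_of_degree_le_one hψ]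
  simp

theorem IsClassicalWith.gamma_one :
    γ 1 = -(φ.eval (-(ψ.coeff 0 / ψ.coeff 1)) / dCoef φ ψ 1) := by
  have h0 : dCoef φ ψ 0 ≠ 0 := h.dCoef_ne_zero hP le_rfl
  have h1 : dCoef φ ψ 1 ≠ 0 := h.dCoef_ne_zero hP (by omega)
  have h2 : dCoef φ ψ 2 ≠ 0 := h.dCoef_ne_zero hP (by omega)
  have f1 := h.coeff_pred hP 0
  have f2 := h.coeff_pred hP 1
  have g2 := h.coeff_pred_pred hP 0
  rw [eval_quadratic h.2.2.1, hT.gamma_one hP, hT.beta_succ hP]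
  simp only [dCoef, eCoef] at h0 h1 h2 f1 f2 g2 ⊢
  push_cast at h0 h1 h2 f1 f2 g2 ⊢
  simp only [zero_mul, zero_add, one_mul] at h0 h1 h2 f1 f2 g2 ⊢
  generalize φ.coeff 2 = a at *
  generalize φ.coeff 1 = b at *
  generalize φ.coeff 0 = c at *
  generalize ψ.coeff 1 = p at *
  generalize ψ.coeff 0 = q at *
  rw [mul_comm, ← eq_div_iff h0] at f1
  rw [mul_comm, ← eq_div_iff h2] at f2
  rw [mul_comm, ← eq_div_iff (mul_ne_zero two_ne_zero h1)] at g2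
  rw [g2, f1, f2]
  field_simp
  ring

omit hP h hT in
/-- The closed form of `γ n` for `n ≥ 2`, with all the `d` and `e` that occur expressed through
`x = d_{2n-2}` and `e = e_{n-1}`. -/
theorem gamma_identity {a b c x e N F₁ F₂ G₁ G₂ : ℂ} (h1 : x - a ≠ 0) (h2 : x ≠ 0)
    (h3 : x + a ≠ 0) (h4 : x + 2 * a ≠ 0) (f1 : x * F₁ = N * e)
    (f2 : (x + 2 * a) * F₂ = (N + 1) * (e + b))
    (g1 : 2 * (x - a) * G₁ = (N - 1) * ((e - b) * F₁ + N * c))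
    (g2 : 2 * (x + a) * G₂ = N * (e * F₂ + (N + 1) * c)) :
    G₁ - G₂ - (F₁ - F₂) * F₁ = -(N * (x - N * a) / ((x - a) * (x + a)) *
      (a * (-(e / x)) ^ 2 + b * -(e / x) + c)) := by
  rw [mul_comm, ← eq_div_iff h2] at f1
  rw [mul_comm, ← eq_div_iff h4] at f2
  rw [mul_comm, ← eq_div_iff (mul_ne_zero two_ne_zero h1)] at g1
  rw [mul_comm, ← eq_div_iff (mul_ne_zero two_ne_zero h3)] at g2
  rw [g1, g2, f1, f2]
  field_simp
  ring

theorem IsClassicalWith.gamma_eq {n : ℕ} (hn : 2 ≤ n) : γ n =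
    -(n * dCoef φ ψ ((n : ℤ) - 2) /
      (dCoef φ ψ (2 * (n : ℤ) - 3) * dCoef φ ψ (2 * (n : ℤ) - 1)) *
      φ.eval (-(eCoef φ ψ ((n : ℤ) - 1) / dCoef φ ψ (2 * (n : ℤ) - 2)))) := by
  obtain ⟨n, rfl⟩ := Nat.exists_eq_add_of_le' hn
  have h1 : dCoef φ ψ (2 * n + 1) ≠ 0 := h.dCoef_ne_zero hP (by omega)
  have h2 : dCoef φ ψ (2 * n + 2) ≠ 0 := h.dCoef_ne_zero hP (by omega)
  have h3 : dCoef φ ψ (2 * n + 3) ≠ 0 := h.dCoef_ne_zero hP (by omega)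
  have h4 : dCoef φ ψ (2 * n + 4) ≠ 0 := h.dCoef_ne_zero hP (by omega)
  have f1 := h.coeff_pred hP (n + 1)
  have f2 := h.coeff_pred hP (n + 2)
  have g1 := h.coeff_pred_pred hP n
  have g2 := h.coeff_pred_pred hP (n + 1)
  rw [eval_quadratic h.2.2.1, hT.gamma_add_two hP, hT.beta_succ hP]
  have key := gamma_identity (a := φ.coeff 2) (b := φ.coeff 1) (c := φ.coeff 0)
    (x := dCoef φ ψ (2 * n + 2)) (e := eCoef φ ψ (n + 1)) (N := n + 2)
    (F₁ := (P (n + 2)).coeff (n + 1)) (F₂ := (P (n + 3)).coeff (n + 2))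
    (G₁ := (P (n + 2)).coeff n) (G₂ := (P (n + 3)).coeff (n + 1))
    (fun h0 => h1 (by rw [← h0]; simp only [dCoef]; push_cast; ring)) h2
    (fun h0 => h3 (by rw [← h0]; simp only [dCoef]; push_cast; ring))
    (fun h0 => h4 (by rw [← h0]; simp only [dCoef]; push_cast; ring))
    (by simp only [dCoef, eCoef] at f1 ⊢; push_cast at f1 ⊢; linear_combination f1)
    (by simp only [dCoef, eCoef] at f2 ⊢; push_cast at f2 ⊢; linear_combination f2)
    (by simp only [dCoef, eCoef] at g1 ⊢; push_cast at g1 ⊢; linear_combination g1)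
    (by simp only [dCoef, eCoef] at g2 ⊢; push_cast at g2 ⊢; linear_combination g2)
  rw [key]
  simp only [dCoef, eCoef]
  push_cast
  ring_nf

end

/-! ### The structure relation -/

section

variable (hP : IsMonicOP u P) (h : IsClassicalWith u φ ψ) {β γ : ℕ → ℂ}

include hP

theorem IsMonicOP.apply_self {n : ℕ} (hn : 1 ≤ n) : u (P n) = 0 := by
  have := hP.apply_mul_ne (m := n) (n := 0) (by omega)
  rwa [hP.zero_eq_one, mul_one] at this

theorem IsMonicOP.apply_linear (hT : TTRR P β γ) (hψ : ψ.degree ≤ 1) (n : ℕ) :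
    u (P n * (ψ * P n)) = ψ.eval (β n) * u (P n * P n) := by
  have h1 : P n * (ψ * P n) =
      C (ψ.coeff 1) * (P n * (X * P n)) + C (ψ.coeff 0) * (P n * P n) := by
    conv_lhs => rw [eq_X_add_C_of_degree_le_one hψ]
    ring
  rw [h1, map_add, map_C_mul, map_C_mul, hP.apply_X_mul hT, eval_linear hψ]
  ring

include h

theorem IsClassicalWith.degree_mul_derivative_le (n : ℕ) :
    (φ * derivative (P n)).degree ≤ ((n + 1 : ℕ) : WithBot ℕ) := by
  simpa using degree_pearson_le h.2.2.1 (ψ := 0) (by simp) (hP.degree_eq n).le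

theorem IsClassicalWith.coeff_mul_derivative (n : ℕ) :
    (φ * derivative (P n)).coeff (n + 1) = n * φ.coeff 2 := by
  simpa [dCoef, hP.coeff_self] using
    coeff_pearson_of_degree_le h.2.2.1 (ψ := 0) (by simp) (hP.degree_eq n).le

theorem IsClassicalWith.apply_mul_derivative_of_lt {j n : ℕ} (hj : j + 1 < n) :
    u (P j * (φ * derivative (P n))) = 0 := by
  rw [h.2.2.2.2.apply_mul_derivative, hP.apply_mul_of_degree_lt, neg_zero]
  exact (degree_pearson_le h.2.2.1 h.2.2.2.1 (hP.degree_eq j).le).trans_lt (by exact_mod_cast hj)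

theorem IsClassicalWith.apply_mul_derivative_pred (n : ℕ) :
    u (P n * (φ * derivative (P (n + 1)))) = -dCoef φ ψ n * u (P (n + 1) * P (n + 1)) := by
  rw [h.2.2.2.2.apply_mul_derivative, hP.apply_mul_of_degree_le
    (degree_pearson_le h.2.2.1 h.2.2.2.1 (hP.degree_eq n).le),
    coeff_pearson_of_degree_le h.2.2.1 h.2.2.2.1 (hP.degree_eq n).le, hP.coeff_self]
  ring

theorem IsClassicalWith.apply_mul_derivative_self (hT : TTRR P β γ) (n : ℕ) :
    u (P n * (φ * derivative (P n))) = -(1 / 2) * ψ.eval (β n) * u (P n * P n) := by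
  have h1 := h.2.2.2.2.apply_mul_derivative (P n) (P n)
  rw [mul_add, map_add, hP.apply_linear hT h.2.2.2.1] at h1
  linear_combination (1 / 2) * h1

theorem IsClassicalWith.structure_relation (hT : TTRR P β γ) (n : ℕ) :
    φ * derivative (P n) = C (n * φ.coeff 2) * P (n + 1) +
      C (-(1 / 2) * ψ.eval (β n)) * P n + C (-dCoef φ ψ ((n : ℤ) - 1) * γ n) * prev P n := by
  have h1 := hP.three_term (h.degree_mul_derivative_le hP n)
    (fun j hj => h.apply_mul_derivative_of_lt hP hj)
  rw [h.coeff_mul_derivative hP, h.apply_mul_derivative_self hP hT,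
    mul_div_cancel_right₀ _ (hP.norm_ne_zero n)] at h1
  rw [h1]
  congr 1
  rcases n with _ | n
  · simp [prev]
  · simp only [prev, if_neg (Nat.succ_ne_zero n), Nat.add_sub_cancel]
    rw [h.apply_mul_derivative_pred hP, hP.norm_succ hT, ← mul_assoc,
      mul_div_cancel_right₀ _ (hP.norm_ne_zero n)]
    push_cast
    rw [add_sub_cancel_right]

theorem IsClassicalWith.structureRelation_iff (hT : TTRR P β γ) (a b c : ℕ → ℂ) :
    StructureRelation P φ a b c ↔
      (∀ n : ℕ, a n = n * φ.coeff 2) ∧ (∀ n, b n = -(1 / 2) * ψ.eval (β n)) ∧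
        ∀ n : ℕ, 1 ≤ n → c n = -dCoef φ ψ ((n : ℤ) - 1) * γ n := by
  have hs := h.structure_relation hP hT
  constructor
  · rintro ⟨-, h2⟩
    have h3 := fun n => hP.coeffs_unique ((h2 n).symm.trans (hs n))
    exact ⟨fun n => (h3 n).1, fun n => (h3 n).2.1, fun n => (h3 n).2.2⟩
  · rintro ⟨ha, hb, hc⟩
    refine ⟨fun n hn => ?_, fun n => ?_⟩
    · rw [hc n hn]
      exact mul_ne_zero (neg_ne_zero.mpr (h.dCoef_ne_zero hP (by omega))) (hP.gamma_ne_zero hT hn)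
    · rw [hs, ha, hb]
      rcases n with _ | n
      · simp [prev]
      · rw [hc _ (by omega)]

omit h

/-- The functional `D(φ u)` is a multiple of `P 1 u` once it vanishes at all `P n` with `n ≥ 2`;
at `P 0 = 1` it vanishes anyway. -/
theorem pearson_of_apply_mul_derivative (h : ∀ n, 2 ≤ n → u (φ * derivative (P n)) = 0) :
    Pearson u φ (C (-u φ / u (P 1 * P 1)) * P 1) := by
  refine hP.functional_ext fun n => ?_
  rw [derivF_apply, mulF_apply, mulF_apply, mul_assoc, map_C_mul]
  rcases n with _ | _ | n
  · rw [hP.zero_eq_one, mul_one, hP.apply_self le_rfl]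
    simp
  · have h2 : derivative (P (0 + 1)) = 1 := by
      rw [eq_X_add_C_of_degree_le_one (hP.degree_eq 1).le, hP.coeff_self]; simp
    rw [h2, mul_one, zero_add, div_mul_cancel₀ _ (hP.norm_ne_zero 1)]
  · rw [h _ (by omega), hP.apply_mul_ne (show 1 ≠ n + 1 + 1 by omega)]
    simp

theorem isClassicalWith_of_apply_mul_derivative (h0 : φ ≠ 0) (hφ : φ.degree ≤ 2)
    (h : ∀ n, 2 ≤ n → u (φ * derivative (P n)) = 0) :
    IsClassicalWith u φ (C (-u φ / u (P 1 * P 1)) * P 1) := by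
  have hp := pearson_of_apply_mul_derivative hP h
  exact ⟨h0, hp.right_ne_zero hP h0, hφ, (degree_C_mul_le' _ _).trans (hP.degree_eq 1).le, hp⟩

theorem StructureRelation.isClassicalWith {a b c : ℕ → ℂ} (hφ : φ.degree ≤ 2)
    (h : StructureRelation P φ a b c) : ∃ ψ, IsClassicalWith u φ ψ := by
  refine ⟨_, isClassicalWith_of_apply_mul_derivative hP ?_ hφ fun n hn => ?_⟩
  · rintro rfl
    have h1 := h.2 1
    refine h.1 1 le_rfl ((hP.coeffs_unique (n := 1) (a := a 1) (b := b 1) (c := c 1) (a' := 0)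
      (b' := 0) (c' := 0) ?_).2.2 le_rfl)
    rw [← h1]; simp
  · have hpr : prev P n = P (n - 1) := if_neg (by omega)
    rw [h.2 n, map_add, map_add, map_C_mul, map_C_mul, map_C_mul, hpr, hP.apply_self (by omega),
      hP.apply_self (by omega), hP.apply_self (by omega)]
    simp

/-! ### McCarthy's relation -/

include h

/-- The structure relations for `P (n + 1)` and `P n` are combined; the recurrence relation
eliminates `P (n + 2)` and `P (n - 1)`, and `beta_recurrence` adjusts the coefficient of
`P (n + 1) P n`. -/
theorem IsClassicalWith.mcCarthyRelation (hT : TTRR P β γ) :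
    McCarthyRelation P φ ψ (fun n => dCoef φ ψ (2 * (n : ℤ) - 3))
      (fun n => -dCoef φ ψ (2 * (n : ℤ) - 1) * γ n) := by
  intro n hn
  obtain ⟨n, rfl⟩ := Nat.exists_eq_add_of_le' hn
  rw [Nat.add_sub_cancel, derivative_mul]
  have s1 := h.structure_relation hP hT (n + 1)
  have s0 := h.structure_relation hP hT n
  have t1 := hT.2 (n + 1)
  have t0 := hT.2 n
  have hb := congrArg C (h.beta_recurrence hP hT n)
  have hψ := eq_X_add_C_of_degree_le_one h.2.2.2.1
  have hφ : derivative φ = C 2 * C (φ.coeff 2) * X + C (φ.coeff 1) := by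
    conv_lhs => rw [eq_quadratic_of_degree_le_two h.2.2.1]
    simp only [derivative_add, derivative_C_mul, derivative_X_pow, derivative_C, derivative_X]
    simp
    ring
  have hpr : prev P (n + 1) = P n := by simp [prev]
  rw [hpr] at s1 t1
  have h2 : (C (1 / 2 : ℂ)) * 2 = 1 := by
    rw [show (2 : ℂ[X]) = C 2 from rfl, ← C_mul]; norm_num
  rw [eval_linear h.2.2.2.1] at s0 s1
  rw [hφ]
  simp only [dCoef, C_neg, C_mul] at s1 s0 hb ⊢
  push_cast at s1 s0 hb ⊢
  simp only [map_add, map_sub, map_mul, map_natCast, map_ofNat, map_one] at s1 s0 hb hφ ⊢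
  linear_combination P n * s1 + P (n + 1) * s0 + (n + 1) * C (φ.coeff 2) * P n * t1 -
    ((n - 1) * C (φ.coeff 2) + C (ψ.coeff 1)) * P (n + 1) * t0 -
    C (1 / 2) * P n * P (n + 1) * hb + P n * P (n + 1) * hψ -
    (C (ψ.coeff 1) * C (β n) + C (ψ.coeff 0) - C (φ.coeff 1) -
      (n + 1) * C (φ.coeff 2) * C (β (n + 1)) + (n - 1) * C (φ.coeff 2) * C (β n)) *
      P n * P (n + 1) * h2

omit h

theorem McCarthyRelation.unique {ψ' : ℂ[X]} {h t h' t' : ℕ → ℂ} (hψ : ψ.degree ≤ 1)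
    (hψ' : ψ'.degree ≤ 1) (H : McCarthyRelation P φ ψ h t) (H' : McCarthyRelation P φ ψ' h' t') :
    ψ = ψ' ∧ ∀ n, 1 ≤ n → h n = h' n ∧ t n = t' n := by
  have key : ∀ n, t (n + 1) = t' (n + 1) ∧
      C (h (n + 1) - h' (n + 1)) * P (n + 1) = (ψ - ψ') * P n := by
    intro n
    have e := (H (n + 1) (by omega)).symm.trans (H' (n + 1) (by omega))
    rw [Nat.add_sub_cancel] at e
    have ht : t (n + 1) = t' (n + 1) := by
      have hd : P (n + 1) ∣ C (t (n + 1) - t' (n + 1)) * P n ^ 2 :=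
        ⟨(ψ - ψ') * P n - C (h (n + 1) - h' (n + 1)) * P (n + 1), by
          rw [C_sub, C_sub]; linear_combination e⟩
      have hd := (hP.isCoprime n).pow_right.dvd_of_dvd_mul_right hd
      by_contra hne
      have := natDegree_le_of_dvd hd (by simpa [sub_eq_zero] using hne)
      rw [hP.natDegree_eq, natDegree_C] at this
      omega
    refine ⟨ht, mul_left_cancel₀ (hP.ne_zero (n + 1)) ?_⟩
    rw [ht] at e
    rw [C_sub]
    linear_combination e
  have hψe : ψ = ψ' := by
    have hd : P 2 ∣ ψ - ψ' := (hP.isCoprime 1).dvd_of_dvd_mul_right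
      ⟨C (h 2 - h' 2), by rw [← (key 1).2]; ring⟩
    by_contra hne
    have h1 := natDegree_le_of_dvd hd (sub_ne_zero.mpr hne)
    have h2 : (ψ - ψ').natDegree ≤ 1 :=
      natDegree_le_of_degree_le ((degree_sub_le _ _).trans (max_le hψ hψ'))
    rw [hP.natDegree_eq] at h1
    omega
  refine ⟨hψe, fun n hn => ?_⟩
  obtain ⟨n, rfl⟩ := Nat.exists_eq_add_of_le' hn
  refine ⟨?_, (key n).1⟩
  have := (key n).2
  rw [hψe, sub_self, zero_mul, mul_eq_zero, or_iff_left (hP.ne_zero _), C_eq_zero] at this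
  exact sub_eq_zero.mp this

/-- For `φ = 0` the pair `ψ = 0` satisfies McCarthy's relation too, and `ψ` is unique. -/
theorem McCarthyRelation.left_ne_zero {h t : ℕ → ℂ} (hψ : ψ.degree ≤ 1) (h0 : ψ ≠ 0)
    (H : McCarthyRelation P φ ψ h t) : φ ≠ 0 := by
  rintro rfl
  exact h0 (McCarthyRelation.unique hP (ψ' := 0) (h' := 0) (t' := 0) hψ (by simp) H
    (fun n _ => by simp)).1

/-- Since `P n` and `P (n - 1)` are coprime, McCarthy's relation yields
`φ P' = A P + t_n P (n - 1)`, where `A` has degree at most one. -/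
theorem McCarthyRelation.apply_mul_derivative {h t : ℕ → ℂ} (hφ : φ.degree ≤ 2)
    (H : McCarthyRelation P φ ψ h t) (n : ℕ) (hn : 2 ≤ n) : u (φ * derivative (P n)) = 0 := by
  obtain ⟨n, rfl⟩ := Nat.exists_eq_add_of_le' (show 1 ≤ n by omega)
  have e := H (n + 1) (by omega)
  rw [Nat.add_sub_cancel, derivative_mul] at e
  have hd : P (n + 1) ∣ (φ * derivative (P (n + 1)) - C (t (n + 1)) * P n) * P n :=
    ⟨C (h (n + 1)) * P (n + 1) - (ψ - derivative φ) * P n - φ * derivative (P n), by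
      linear_combination e⟩
  obtain ⟨A, hA⟩ := (hP.isCoprime n).dvd_of_dvd_mul_right hd
  have hA1 : A.natDegree ≤ 1 := by
    rcases eq_or_ne A 0 with rfl | hA0
    · simp
    have h1 := congrArg natDegree hA
    rw [natDegree_mul (hP.ne_zero _) hA0, hP.natDegree_eq] at h1
    have h2 : (φ * derivative (P (n + 1)) - C (t (n + 1)) * P n).natDegree ≤ n + 2 := by
      refine (natDegree_sub_le _ _).trans (max_le ?_ ?_)
      · have h3 := natDegree_derivative_le (P (n + 1))
        rw [hP.natDegree_eq] at h3
        have h4 : φ.natDegree ≤ 2 := natDegree_le_of_degree_le hφ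
        exact natDegree_mul_le.trans (by omega)
      · refine (natDegree_C_mul_le _ _).trans ?_
        rw [hP.natDegree_eq]; omega
    omega
  have h5 : φ * derivative (P (n + 1)) = P (n + 1) * A + C (t (n + 1)) * P n := by
    linear_combination hA
  rw [h5, map_add, map_C_mul, hP.apply_self (by omega), hP.apply_mul_of_degree_lt]
  · simp
  · exact degree_le_natDegree.trans_lt (by exact_mod_cast (by omega))

theorem McCarthyRelation.isClassicalWith {h t : ℕ → ℂ} (ha : IsAdmissible φ ψ)
    (H : McCarthyRelation P φ ψ h t) : IsClassicalWith u φ ψ := by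
  have h0 : ψ ≠ 0 := by
    rintro rfl
    simpa [dCoef] using ha.2.2 0
  have hc := isClassicalWith_of_apply_mul_derivative hP (H.left_ne_zero hP ha.2.1 h0) ha.1
    (H.apply_mul_derivative hP ha.1)
  obtain ⟨β, γ, hT⟩ := hP.exists_ttrr
  rwa [(H.unique hP ha.2.1 hc.2.2.2.1 (hc.mcCarthyRelation hP hT)).1]

include h

theorem IsClassicalWith.mcCarthyRelation_iff (hT : TTRR P β γ) (a t : ℕ → ℂ) :
    McCarthyRelation P φ ψ a t ↔ ∀ n : ℕ, 1 ≤ n → a n = dCoef φ ψ (2 * (n : ℤ) - 3) ∧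
      t n = -dCoef φ ψ (2 * (n : ℤ) - 1) * γ n := by
  have hM := h.mcCarthyRelation hP hT
  refine ⟨fun H => (H.unique hP h.2.2.2.1 h.2.2.2.1 hM).2, fun H n hn => ?_⟩
  rw [(H n hn).1, (H n hn).2]
  exact hM n hn

end

/-! ### Rodrigues' formula -/

theorem iterate_derivF_apply (v : Functional) (n : ℕ) (p : ℂ[X]) :
    derivF^[n] v p = (-1) ^ n * v (derivative^[n] p) := by
  induction n generalizing v with
  | zero => simp
  | succ n ih =>
    rw [Function.iterate_succ_apply, ih, derivF_apply, Function.iterate_succ_apply',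
      pow_succ]
    ring

theorem Pearson.pow_mul (h : Pearson u φ ψ) (m : ℕ) (q : ℂ[X]) :
    derivF (mulF (φ ^ (m + 1) * q) u) =
      mulF (φ ^ m * (φ * derivative q + (ψ + C (m : ℂ) * derivative φ) * q)) u := by
  refine LinearMap.ext fun p => ?_
  have h1 := pearson_iff.mp h (φ ^ m * q * p)
  suffices h2 : φ ^ (m + 1) * q * derivative p +
      φ ^ m * (φ * derivative q + (ψ + C (m : ℂ) * derivative φ) * q) * p =
      φ * derivative (φ ^ m * q * p) + ψ * (φ ^ m * q * p) by
    rw [derivF_apply, mulF_apply, mulF_apply, neg_eq_iff_add_eq_zero, ← map_add, h2, h1]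
  rcases m with _ | m
  · simp only [derivative_mul, pow_zero, one_mul, zero_add, pow_one, Nat.cast_zero, map_zero,
      zero_mul, add_zero]
    ring
  · simp only [derivative_mul, derivative_pow, map_natCast, Nat.add_sub_cancel]
    push_cast
    ring

theorem degree_add_derivative_le (hφ : φ.degree ≤ 2) (hψ : ψ.degree ≤ 1) (c : ℂ) :
    (ψ + C c * derivative φ).degree ≤ 1 := by
  refine (degree_add_le _ _).trans (max_le hψ ((degree_C_mul_le' _ _).trans ?_))
  have h1 : φ.natDegree ≤ 2 := natDegree_le_of_degree_le hφ
  have h2 := natDegree_derivative_le φ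
  exact degree_le_natDegree.trans (by exact_mod_cast (by omega : (derivative φ).natDegree ≤ 1))

theorem dCoef_add_derivative (c : ℂ) (j : ℤ) :
    dCoef φ (ψ + C c * derivative φ) j = j * φ.coeff 2 + ψ.coeff 1 + 2 * c * φ.coeff 2 := by
  simp [dCoef, coeff_derivative]
  ring

/-- Each of the `m` derivatives lowers the power of `φ` by one and raises the degree of the other
factor by one; its leading coefficient picks up some `d_i`. -/
theorem Pearson.iterate (h : Pearson u φ ψ) (hφ : φ.degree ≤ 2) (hψ : ψ.degree ≤ 1) (m : ℕ) :
    ∀ (j : ℕ) (q : ℂ[X]), q.degree ≤ j → ∃ R : ℂ[X], R.degree ≤ ((j + m : ℕ) : WithBot ℕ) ∧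
      R.coeff (j + m) =
        q.coeff j * ∏ i ∈ Finset.range m, dCoef φ ψ ((j : ℤ) + (m : ℤ) + (i : ℤ) - 1) ∧
      derivF^[m] (mulF (φ ^ m * q) u) = mulF R u := by
  induction m with
  | zero => intro j q hq; exact ⟨q, hq, by simp, by simp⟩
  | succ m ih =>
    intro j q hq
    have hχ := degree_add_derivative_le hφ hψ (m : ℂ)
    obtain ⟨R, hR1, hR2, hR3⟩ := ih (j + 1) _ (degree_pearson_le hφ hχ hq)
    refine ⟨R, by rwa [show j + (m + 1) = j + 1 + m by ring], ?_, ?_⟩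
    · rw [show j + (m + 1) = j + 1 + m by ring, hR2, coeff_pearson_of_degree_le hφ hχ hq,
        dCoef_add_derivative, Finset.prod_range_succ]
      have e1 : ∀ i : ℕ, ((j + 1 : ℕ) : ℤ) + (m : ℤ) + (i : ℤ) - 1 =
          (j : ℤ) + ((m + 1 : ℕ) : ℤ) + (i : ℤ) - 1 := fun i => by push_cast; ring
      simp only [e1]
      have e2 : dCoef φ ψ ((j : ℤ) + ((m + 1 : ℕ) : ℤ) + (m : ℤ) - 1) =
          j * φ.coeff 2 + ψ.coeff 1 + 2 * m * φ.coeff 2 := by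
        simp only [dCoef]; push_cast; ring
      rw [e2]
      push_cast
      ring
    · rw [Function.iterate_succ_apply, h.pow_mul, hR3]

section

variable (hP : IsMonicOP u P)
include hP

theorem IsClassicalWith.iterate_derivF (h : IsClassicalWith u φ ψ) (n : ℕ) :
    derivF^[n] (mulF (φ ^ n) u) =
      mulF (C (∏ i ∈ Finset.range n, dCoef φ ψ ((n : ℤ) + (i : ℤ) - 1)) * P n) u := by
  obtain ⟨R, hR1, hR2, hR3⟩ := h.2.2.2.2.iterate h.2.2.1 h.2.2.2.1 n 0 1 (by simp)
  rw [mul_one] at hR3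
  simp only [zero_add, coeff_one_zero, one_mul, Nat.cast_zero] at hR1 hR2
  rw [hR3, ← hR2]
  congr 1
  rw [← sub_eq_zero]
  refine hP.eq_zero_of_apply_mul fun j hj => ?_
  have hj : j ≤ n := hj.trans (natDegree_le_of_degree_le ((degree_sub_le _ _).trans
    (max_le hR1 ((degree_C_mul_le' _ _).trans (hP.degree_eq n).le))))
  rw [mul_sub, map_sub, mul_left_comm, map_C_mul]
  rcases hj.eq_or_lt with rfl | hj
  · rw [hP.apply_mul_of_degree_le hR1, sub_self]
  · have h1 := congrArg (fun v : Functional => v (P j)) hR3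
    simp only [mulF_apply] at h1
    rw [iterate_derivF_apply, iterate_derivative_eq_zero (by rwa [hP.natDegree_eq]), map_zero,
      mul_zero] at h1
    rw [mul_comm (P j), ← h1, hP.apply_mul_ne hj.ne]
    simp

theorem IsClassicalWith.rodriguesFormula_iff (h : IsClassicalWith u φ ψ) (k : ℕ → ℂ) :
    RodriguesFormula u P φ k ↔
      ∀ n : ℕ, k n = ∏ i ∈ Finset.range n, (dCoef φ ψ ((n : ℤ) + (i : ℤ) - 1))⁻¹ := by
  have h0 : ∀ n : ℕ, ∏ i ∈ Finset.range n, dCoef φ ψ ((n : ℤ) + (i : ℤ) - 1) ≠ 0 := fun n =>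
    Finset.prod_ne_zero_iff.mpr fun i hi =>
      h.dCoef_ne_zero hP (by have := Finset.mem_range.mp hi; omega)
  have h1 : ∀ (c : ℂ) (q : ℂ[X]), c • mulF q u = mulF (C c * q) u := fun c q =>
    LinearMap.ext fun p => by simp [mul_assoc, map_C_mul]
  simp only [RodriguesFormula, h.iterate_derivF hP, h1, Finset.prod_inv_distrib]
  constructor
  · rintro ⟨-, h2⟩ n
    have h3 := hP.mulF_injective (h2 n)
    have h4 := congrArg (fun p => coeff p n) h3
    simp only [coeff_C_mul, hP.coeff_self, mul_one] at h4
    exact eq_inv_of_mul_eq_one_left h4.symm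
  · intro hk
    refine ⟨fun n => by rw [hk]; exact inv_ne_zero (h0 n), fun n => ?_⟩
    rw [hk, ← mul_assoc, ← C_mul, inv_mul_cancel₀ (h0 n), C_1, one_mul]

theorem RodriguesFormula.isClassicalWith {k : ℕ → ℂ} (hφ : φ.degree ≤ 2)
    (h : RodriguesFormula u P φ k) : ∃ ψ, IsClassicalWith u φ ψ := by
  have h1 := h.2 1
  rw [pow_one, Function.iterate_one] at h1
  have hk : k 1 ≠ 0 := h.1 1
  have h2 : Pearson u φ (C (k 1)⁻¹ * P 1) := by
    refine LinearMap.ext fun p => ?_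
    have h3 := congrArg (fun v : Functional => v p) h1
    simp only [mulF_apply, LinearMap.smul_apply, smul_eq_mul] at h3
    rw [mulF_apply, mul_assoc, map_C_mul, h3, inv_mul_cancel_left₀ hk]
  have h3 : C (k 1)⁻¹ * P 1 ≠ 0 := mul_ne_zero (by simpa using hk) (hP.ne_zero 1)
  exact ⟨_, h2.left_ne_zero hP h3, h3, hφ,
    (degree_C_mul_le' _ _).trans (hP.degree_eq 1).le, h2⟩

end

/-! ### The formal Stieltjes series -/

theorem polyAtInfty_mul_coeff (hφ : φ.degree ≤ 2) (f : LaurentSeries ℂ) (m : ℤ) :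
    (polyAtInfty φ * f).coeff m =
      φ.coeff 2 * f.coeff (m + 2) + φ.coeff 1 * f.coeff (m + 1) + φ.coeff 0 * f.coeff m := by
  have h1 : ∀ (p : ℂ[X]) (m : ℤ),
      (polyAtInfty (X * p) * f).coeff m = (polyAtInfty p * f).coeff (m + 1) := by
    intro p m
    rw [map_mul, mul_assoc, polyAtInfty, aeval_X, HahnSeries.coeff_single_mul]
    simp
  have h2 : ∀ (a : ℂ) (p : ℂ[X]) (m : ℤ),
      (polyAtInfty (C a * p) * f).coeff m = a * (polyAtInfty p * f).coeff m := by
    intro a p m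
    have h4 : polyAtInfty (C a) = HahnSeries.single (0 : ℤ) a := by
      rw [polyAtInfty, aeval_C, HahnSeries.algebraMap_apply', PowerSeries.algebraMap_apply,
        HahnSeries.ofPowerSeries_C]
      rfl
    rw [map_mul, mul_assoc, h4, HahnSeries.coeff_single_mul, sub_zero]
  have h3 : φ = C (φ.coeff 2) * (X * (X * 1)) + C (φ.coeff 1) * (X * 1) + C (φ.coeff 0) * 1 := by
    conv_lhs => rw [eq_quadratic_of_degree_le_two hφ]
    ring
  conv_lhs => rw [h3]
  rw [map_add, map_add, add_mul, add_mul]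
  simp only [HahnSeries.coeff_add, h1, h2, map_one, one_mul]
  rw [add_assoc m 1 1, one_add_one_eq_two]

theorem derivZ_coeff (f : LaurentSeries ℂ) (m : ℤ) :
    (derivZ f).coeff m = -((m - 1 : ℤ) * f.coeff (m - 1)) := by
  rw [derivZ, HahnSeries.coeff_neg, HahnSeries.coeff_single_mul, LaurentSeries.derivative_apply,
    LaurentSeries.hasseDeriv_coeff]
  simp only [one_mul, Nat.cast_one, Ring.choose_one_right', pow_one, zsmul_eq_mul]
  rw [show m - 2 + 1 = m - 1 by ring]

theorem stieltjes_coeff_of_nonpos (u : Functional) {m : ℤ} (hm : m ≤ 0) :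
    (stieltjes u).coeff m = 0 := by
  rw [stieltjes, HahnSeries.coeff_neg, neg_eq_zero]
  rw [PowerSeries.coeff_coe]
  split_ifs with h
  · rfl
  · have : m = 0 := by omega
    subst this
    simp

theorem stieltjes_coeff (u : Functional) (n : ℕ) :
    (stieltjes u).coeff ((n : ℤ) + 1) = -u (X ^ n) := by
  rw [stieltjes, HahnSeries.coeff_neg, neg_inj]
  rw [PowerSeries.coeff_coe, if_neg (by omega), show ((n : ℤ) + 1).natAbs = n + 1 by omega,
    PowerSeries.coeff_succ_X_mul, PowerSeries.coeff_mk]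

theorem apply_pearson_X_pow (hφ : φ.degree ≤ 2) (hψ : ψ.degree ≤ 1) (u : Functional) (n : ℕ) :
    u (φ * derivative (X ^ n) + ψ * X ^ n) = dCoef φ ψ n * u (X ^ (n + 1)) +
      eCoef φ ψ n * u (X ^ n) + n * φ.coeff 0 * u (X ^ (n - 1)) := by
  have h1 : φ * derivative (X ^ n) + ψ * X ^ n = C (dCoef φ ψ n) * X ^ (n + 1) +
      C (eCoef φ ψ n) * X ^ n + C (n * φ.coeff 0) * X ^ (n - 1) := by
    conv_lhs => rw [eq_quadratic_of_degree_le_two hφ, eq_X_add_C_of_degree_le_one hψ]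
    rw [derivative_X_pow]
    rcases n with _ | n
    · simp [dCoef, eCoef]
    · simp only [dCoef, eCoef, map_add, map_mul, Nat.add_sub_cancel]
      push_cast
      ring
  rw [h1, map_add, map_add, map_C_mul, map_C_mul, map_C_mul]

theorem stieltjesEq_iff (hφ : φ.degree ≤ 2) (hψ : ψ.degree ≤ 1) :
    StieltjesEq u φ ψ ↔ Pearson u φ ψ := by
  have hχ : (ψ - derivative φ).degree ≤ 1 := by
    simpa [sub_eq_add_neg] using degree_add_derivative_le hφ hψ (-1)
  have hc0 : derivative ψ - C (1 / 2 : ℂ) * derivative (derivative φ) =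
      C (ψ.coeff 1 - φ.coeff 2) := by
    conv_lhs => rw [eq_quadratic_of_degree_le_two hφ, eq_X_add_C_of_degree_le_one hψ]
    simp only [derivative_add, derivative_X_pow, derivative_C, derivative_X,
      derivative_mul]
    rw [C_sub]
    have : C (2⁻¹ : ℂ) * C 2 = 1 := by
      rw [← C_mul]; norm_num
    simp
    linear_combination C (φ.coeff 2) * this
  have hP : Pearson u φ ψ ↔ ∀ n : ℕ, u (φ * derivative (X ^ n) + ψ * X ^ n) = 0 := by
    rw [pearson_iff]
    refine ⟨fun h n => h _, fun h q => ?_⟩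
    induction q using Polynomial.induction_on' with
    | add p q hp hq =>
      rw [derivative_add, mul_add, mul_add, add_add_add_comm, map_add, hp, hq, add_zero]
    | monomial n a =>
      rw [← C_mul_X_pow_eq_monomial, derivative_C_mul, mul_left_comm, mul_left_comm ψ, ← mul_add,
        map_C_mul, h, mul_zero]
  -- the coefficient of `z ^ (-n-1)` on both sides
  have key : ∀ m : ℤ, (polyAtInfty φ * derivZ (stieltjes u)).coeff m -
      (polyAtInfty (ψ - derivative φ) * stieltjes u +
      polyAtInfty ((derivative ψ - C (1 / 2 : ℂ) * derivative (derivative φ)) * C (u 1))).coeff m =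
      if 0 < m then u (φ * derivative (X ^ (m - 1).toNat) + ψ * X ^ (m - 1).toNat) else 0 := by
    intro m
    have hχ2 : (ψ - derivative φ).coeff 2 = 0 :=
      coeff_eq_zero_of_degree_lt (hχ.trans_lt (by norm_num))
    have hc : (polyAtInfty (C ((ψ.coeff 1 - φ.coeff 2) * u 1))).coeff m =
        if m = 0 then (ψ.coeff 1 - φ.coeff 2) * u 1 else 0 := by
      rw [← mul_one (polyAtInfty _), polyAtInfty_mul_coeff (degree_C_le.trans (by norm_num))]
      simp [coeff_C, HahnSeries.coeff_one]
    rw [HahnSeries.coeff_add, polyAtInfty_mul_coeff hφ,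
      polyAtInfty_mul_coeff (hχ.trans (by norm_num)), hc0, ← C_mul, hc, hχ2]
    simp only [derivZ_coeff, coeff_sub, coeff_derivative]
    rcases lt_trichotomy m 0 with hm | rfl | hm
    · rw [if_neg (by omega), if_neg (by omega)]
      simp only [stieltjes_coeff_of_nonpos u (show m + 1 ≤ 0 by omega),
        stieltjes_coeff_of_nonpos u (show m ≤ 0 by omega),
        stieltjes_coeff_of_nonpos u (show m - 1 ≤ 0 by omega),
        show m + 2 - 1 = m + 1 by ring, show m + 1 - 1 = m by ring]
      ring
    · have h1 := stieltjes_coeff u 0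
      simp only [Nat.cast_zero, zero_add, pow_zero] at h1
      norm_num [h1, stieltjes_coeff_of_nonpos]
      ring
    · obtain ⟨n, rfl⟩ : ∃ n : ℕ, m = n + 1 := ⟨(m - 1).toNat, by omega⟩
      rw [if_neg (by omega), if_pos hm]
      have h2 := stieltjes_coeff u (n + 1)
      push_cast at h2
      simp only [show (n : ℤ) + 1 + 2 - 1 = n + 1 + 1 by ring,
        show (n : ℤ) + 1 + 1 - 1 = n + 1 by ring, show (n : ℤ) + 1 - 1 = n by ring,
        Int.toNat_natCast, stieltjes_coeff, h2, apply_pearson_X_pow hφ hψ]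
      rcases n with _ | n
      · simp [dCoef, eCoef]
        ring
      · rw [Nat.cast_succ, stieltjes_coeff]
        simp only [dCoef, eCoef, Nat.add_sub_cancel]
        push_cast
        ring
  rw [hP]
  constructor
  · intro h n
    have := key (n + 1)
    rw [StieltjesEq] at h
    rw [h, sub_self, if_pos (by omega)] at this
    simpa using this.symm
  · intro h
    rw [StieltjesEq]
    ext m
    have := key m
    rw [← sub_eq_zero, this]
    split_ifs
    · exact h _
    · rfl

/-! ### Normalized derivatives -/

theorem normDeriv_zero (P : ℕ → ℂ[X]) : normDeriv P 0 = P := by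
  funext n
  simp [normDeriv]

theorem normDeriv_succ (P : ℕ → ℂ[X]) (k n : ℕ) :
    normDeriv P (k + 1) n = C ((n : ℂ) + 1)⁻¹ * derivative (normDeriv P k (n + 1)) := by
  rw [normDeriv, normDeriv, derivative_C_mul, ← Function.iterate_succ_apply' (f := derivative),
    ← mul_assoc, ← C_mul, ← mul_inv, show n + (k + 1) = n + 1 + k by ring]
  congr 4
  have := Nat.succ_ascFactorial (n + 1) k
  rw [Nat.ascFactorial_succ, ← this]
  push_cast
  ring

theorem normDeriv_normDeriv_one (P : ℕ → ℂ[X]) (k : ℕ) :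
    normDeriv (normDeriv P k) 1 = normDeriv P (k + 1) := by
  funext n
  rw [normDeriv_succ, normDeriv_succ, normDeriv_zero]

theorem iterate_derivative_eq_normDeriv (P : ℕ → ℂ[X]) (k n : ℕ) :
    derivative^[k] (P (n + k)) = C ((n + 1).ascFactorial k : ℂ) * normDeriv P k n := by
  have : ((n + 1).ascFactorial k : ℂ) ≠ 0 := by
    exact_mod_cast (Nat.ascFactorial_pos n k).ne'
  rw [normDeriv, ← mul_assoc, ← C_mul, mul_inv_cancel₀ this, C_1, one_mul]

theorem coeff_C_inv_mul_derivative (p : ℂ[X]) (n m : ℕ) :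
    (C ((n : ℂ) + 1)⁻¹ * derivative p).coeff m =
      ((n : ℂ) + 1)⁻¹ * (p.coeff (m + 1) * (m + 1)) := by
  rw [coeff_C_mul, coeff_derivative]

theorem normDeriv_monic_degree (hd : ∀ n, (P n).degree = n) (hm : ∀ n, (P n).Monic) (k : ℕ) :
    ∀ n, (normDeriv P k n).degree = n ∧ (normDeriv P k n).Monic := by
  induction k with
  | zero => intro n; rw [normDeriv_zero]; exact ⟨hd n, hm n⟩
  | succ k ih =>
    intro n
    rw [normDeriv_succ]
    have h0 : (n + 1 : ℂ) ≠ 0 := Nat.cast_add_one_ne_zero n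
    have hn := natDegree_eq_of_degree_eq_some (ih (n + 1)).1
    have hc : (C ((n : ℂ) + 1)⁻¹ * derivative (normDeriv P k (n + 1))).coeff n = 1 := by
      have h1 := (ih (n + 1)).2
      rw [Monic, leadingCoeff, hn] at h1
      rw [coeff_C_inv_mul_derivative, h1, one_mul, inv_mul_cancel₀ h0]
    have hle : (C ((n : ℂ) + 1)⁻¹ * derivative (normDeriv P k (n + 1))).natDegree ≤ n := by
      refine (natDegree_C_mul_le _ _).trans ?_
      have := natDegree_derivative_le (normDeriv P k (n + 1))
      rw [hn] at this
      exact this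
    have hM := monic_of_natDegree_le_of_coeff_eq_one n hle hc
    refine ⟨?_, hM⟩
    rw [degree_eq_natDegree hM.ne_zero]
    congr 1
    exact le_antisymm hle (le_natDegree_of_ne_zero (by rw [hc]; exact one_ne_zero))

theorem mulF_mulF (φ ψ : ℂ[X]) (u : Functional) : mulF φ (mulF ψ u) = mulF (ψ * φ) u :=
  LinearMap.ext fun p => by simp [mul_assoc]

section

variable (hP : IsMonicOP u P)
include hP

theorem IsClassicalWith.apply_normDeriv_mul (h : IsClassicalWith u φ ψ) (m n : ℕ) :
    mulF φ u (normDeriv P 1 m * normDeriv P 1 n) =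
      -(dCoef φ ψ m * ((n : ℂ) + 1)⁻¹) * u (P (m + 1) * P (n + 1)) := by
  have h0 : (m + 1 : ℂ) ≠ 0 := Nat.cast_add_one_ne_zero m
  have h1 := h.2.2.2.2.apply_mul_bochner (P (m + 1)) (P (n + 1))
  rw [h.2.2.2.2.bochner_eigen hP h.2.2.1 h.2.2.2.1, mul_left_comm, map_C_mul] at h1
  rw [normDeriv_succ, normDeriv_succ, normDeriv_zero, mulF_apply,
    show φ * (C ((m : ℂ) + 1)⁻¹ * derivative (P (m + 1)) *
      (C ((n : ℂ) + 1)⁻¹ * derivative (P (n + 1)))) = C ((m : ℂ) + 1)⁻¹ * (C ((n : ℂ) + 1)⁻¹ *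
      (φ * (derivative (P (m + 1)) * derivative (P (n + 1))))) by ring, map_C_mul, map_C_mul,
    ← neg_eq_iff_eq_neg.mpr h1, mul_comm (P (m + 1))]
  push_cast
  rw [add_sub_cancel_right]
  field_simp

/-- The derivatives of a classical sequence are orthogonal with respect to `φ u`, and this
functional is classical for `φ` and `ψ + φ'`. -/
theorem IsClassicalWith.normDeriv_one (h : IsClassicalWith u φ ψ) :
    IsMonicOP (mulF φ u) (normDeriv P 1) ∧
      IsClassicalWith (mulF φ u) φ (ψ + C 1 * derivative φ) := by
  have hd := normDeriv_monic_degree hP.degree_eq hP.monic 1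
  have hOP : IsMonicOP (mulF φ u) (normDeriv P 1) := by
    refine ⟨⟨fun n => (hd n).1, fun n => mulF φ u (normDeriv P 1 n * normDeriv P 1 n),
      fun n => ?_, fun m n => ?_⟩, fun n => (hd n).2⟩
    · beta_reduce
      rw [h.apply_normDeriv_mul hP]
      refine mul_ne_zero (neg_ne_zero.mpr (mul_ne_zero (h.dCoef_ne_zero hP (by omega))
        (inv_ne_zero (Nat.cast_add_one_ne_zero n)))) (hP.norm_ne_zero _)
    · split_ifs with hmn
      · rw [hmn]
      · rw [h.apply_normDeriv_mul hP, hP.apply_mul_ne (by omega), mul_zero]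
  have hp : Pearson (mulF φ u) φ (ψ + C 1 * derivative φ) := by
    have := h.2.2.2.2.pow_mul 1 1
    rw [Pearson, mulF_mulF, mulF_mulF]
    simpa [pow_two] using this
  exact ⟨hOP, h.1, hp.right_ne_zero hOP h.1, h.2.2.1,
    degree_add_derivative_le h.2.2.1 h.2.2.2.1 1, hp⟩

theorem IsClassicalWith.exists_normDeriv (h : IsClassicalWith u φ ψ) (k : ℕ) :
    ∃ v χ, IsMonicOP v (normDeriv P k) ∧ IsClassicalWith v φ χ := by
  induction k with
  | zero => exact ⟨u, ψ, by rwa [normDeriv_zero], h⟩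
  | succ k ih =>
    obtain ⟨v, χ, h1, h2⟩ := ih
    rw [← normDeriv_normDeriv_one]
    exact ⟨_, _, h2.normDeriv_one h1⟩

/-- Differentiating the recurrence relation expresses `(k + 1) D^k P` through `D^(k+1) (x P)` and
`x D^(k+1) P`, hence `P^{[k]}` through three neighbours in `P^{[k+1]}` if these are orthogonal. -/
theorem derivRelation_of_isMonicOP (k : ℕ) (hQ : IsMonicOP v (normDeriv P (k + 1))) :
    DerivRelation P (k + 1)
      (fun n => v (normDeriv P (k + 1) (n - 1) * normDeriv P k n) /
        v (normDeriv P (k + 1) (n - 1) * normDeriv P (k + 1) (n - 1)))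
      (fun n => v (normDeriv P (k + 1) (n - 2) * normDeriv P k n) /
        v (normDeriv P (k + 1) (n - 2) *
          normDeriv P (k + 1) (n - 2))) := by
  intro n hn
  obtain ⟨l, rfl⟩ := Nat.exists_eq_add_of_le' hn
  obtain ⟨β, γ, hT⟩ := hP.exists_ttrr
  have hR := normDeriv_monic_degree hP.degree_eq hP.monic k
  have h3 := hQ.three_term (n := l + 1) (p := normDeriv P k (l + 2)) (hR _).1.le ?_
  · have h1 : (normDeriv P k (l + 2)).coeff (l + 1 + 1) = 1 := by
      have := (hR (l + 2)).2
      rwa [Monic, leadingCoeff, natDegree_eq_of_degree_eq_some (hR (l + 2)).1] at this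
    rw [h1, C_1, one_mul] at h3
    simpa [prev] using h3
  · intro i hi
    have e1 : ∀ p : ℂ[X], derivative^[k + 1] (X * p) =
        X * derivative^[k + 1] p + C ((k : ℂ) + 1) * derivative^[k] p := by
      intro p
      have := iterate_derivative_mul_X (n := k + 1) p
      rw [mul_comm X p, this]
      simp
      ring
    have e2 := e1 (P (l + 2 + k))
    rw [hT.X_mul, iterate_map_add, iterate_map_add, iterate_derivative_C_mul,
      iterate_derivative_C_mul, show prev P (l + 2 + k) = P (l + (k + 1)) by
        rw [prev, if_neg (by omega)]; congr 1; omega,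
      show l + 2 + k + 1 = l + 2 + (k + 1) by ring, iterate_derivative_eq_normDeriv,
      iterate_derivative_eq_normDeriv, iterate_derivative_eq_normDeriv,
      show l + 2 + k = l + 1 + (k + 1) by ring, iterate_derivative_eq_normDeriv] at e2
    have e3 := congrArg (fun p => v (normDeriv P (k + 1) i * p)) e2
    have hX : v (normDeriv P (k + 1) i *
        (X * normDeriv P (k + 1) (l + 1))) = 0 := by
      rw [← mul_assoc, mul_comm]
      apply hQ.apply_mul_of_degree_lt
      rw [mul_comm, hQ.degree_X_mul]
      exact_mod_cast hi
    have hC : ∀ (a : ℂ) (p : ℂ[X]), v (normDeriv P (k + 1) i * (C a * p)) =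
        a * v (normDeriv P (k + 1) i * p) := fun a p => by rw [mul_left_comm, map_C_mul]
    simp only [mul_add, map_add v, hC, mul_left_comm X (C _),
      hQ.apply_mul_ne (show i ≠ l + 2 by omega), hQ.apply_mul_ne (show i ≠ l + 1 by omega),
      hQ.apply_mul_ne (show i ≠ l by omega), hX, mul_zero, zero_add] at e3
    have h4 : ((l + 2 + 1).ascFactorial k : ℂ) ≠ 0 := by
      exact_mod_cast (Nat.ascFactorial_pos (l + 2) k).ne'
    have h5 : ((k : ℂ) + 1) ≠ 0 := Nat.cast_add_one_ne_zero k
    simpa [h4, h5] using e3.symm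

theorem IsClassicalWith.derivRelation_one_iff (h : IsClassicalWith u φ ψ) {β γ : ℕ → ℂ}
    (hT : TTRR P β γ) (r s : ℕ → ℂ) :
    DerivRelation P 1 r s ↔ ∀ n : ℕ, 2 ≤ n →
      r n = 1 / 2 * (ψ.eval (β n) / dCoef φ ψ ((n : ℤ) - 1)) ∧
      s n = -(((n : ℂ) - 1) * φ.coeff 2 / dCoef φ ψ ((n : ℤ) - 2)) * γ n := by
  have hQ := (h.normDeriv_one hP).1
  have h1 := derivRelation_of_isMonicOP hP 0 hQ
  have hr : ∀ l : ℕ, mulF φ u (normDeriv P 1 (l + 1) *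
      normDeriv P 0 (l + 2)) /
      mulF φ u (normDeriv P 1 (l + 1) * normDeriv P 1 (l + 1)) =
      1 / 2 * (ψ.eval (β (l + 2)) / dCoef φ ψ (l + 1)) := by
    intro l
    have h0 : dCoef φ ψ (l + 1) ≠ 0 := h.dCoef_ne_zero hP (by omega)
    have h2 : ((l + 1 : ℕ) + 1 : ℂ) ≠ 0 := Nat.cast_add_one_ne_zero (l + 1)
    have h3 := hP.norm_ne_zero (l + 2)
    rw [h.apply_normDeriv_mul hP, normDeriv_zero, normDeriv_succ, normDeriv_zero, mulF_apply,
      show φ * (C (((l + 1 : ℕ) : ℂ) + 1)⁻¹ * derivative (P (l + 1 + 1)) * P (l + 2)) =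
        C (((l + 1 : ℕ) : ℂ) + 1)⁻¹ * (P (l + 2) * (φ * derivative (P (l + 2)))) by ring,
      map_C_mul, h.apply_mul_derivative_self hP hT]
    simp only [Nat.cast_add, Nat.cast_one] at h0 h2 ⊢
    field_simp
  have hs : ∀ l : ℕ, mulF φ u (normDeriv P 1 l *
      normDeriv P 0 (l + 2)) /
      mulF φ u (normDeriv P 1 l * normDeriv P 1 l) =
      -((l + 1) * φ.coeff 2 / dCoef φ ψ l) * γ (l + 2) := by
    intro l
    have h0 : dCoef φ ψ l ≠ 0 := h.dCoef_ne_zero hP (by omega)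
    have h2 : (l + 1 : ℂ) ≠ 0 := Nat.cast_add_one_ne_zero l
    have h3 := hP.norm_ne_zero (l + 1)
    rw [h.apply_normDeriv_mul hP, normDeriv_zero, normDeriv_succ, normDeriv_zero, mulF_apply,
      show φ * (C ((l : ℂ) + 1)⁻¹ * derivative (P (l + 1)) * P (l + 2)) =
        C ((l : ℂ) + 1)⁻¹ * (P (l + 2) * (φ * derivative (P (l + 1)))) by ring,
      map_C_mul, hP.apply_mul_of_degree_le (h.degree_mul_derivative_le hP (l + 1)),
      h.coeff_mul_derivative hP, hP.norm_succ hT]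
    push_cast
    field_simp
  have key : ∀ n : ℕ, 2 ≤ n → (∀ r s : ℂ, normDeriv P 0 n =
      normDeriv P 1 n + C r * normDeriv P 1 (n - 1) +
        C s * normDeriv P 1 (n - 2) ↔
      r = 1 / 2 * (ψ.eval (β n) / dCoef φ ψ ((n : ℤ) - 1)) ∧
      s = -(((n : ℂ) - 1) * φ.coeff 2 / dCoef φ ψ ((n : ℤ) - 2)) * γ n) := by
    intro n hn r s
    obtain ⟨l, rfl⟩ := Nat.exists_eq_add_of_le' hn
    have h4 := h1 (l + 2) hn
    simp only [show l + 2 - 1 = l + 1 from rfl, Nat.add_sub_cancel, zero_add, hr, hs] at h4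
    rw [show ((l + 2 : ℕ) : ℤ) - 1 = l + 1 by push_cast; ring,
      show ((l + 2 : ℕ) : ℤ) - 2 = l by push_cast; ring,
      show ((l + 2 : ℕ) : ℂ) - 1 = l + 1 by push_cast; ring,
      show l + 2 - 1 = l + 1 from rfl, Nat.add_sub_cancel]
    constructor
    · intro h5
      have h6 := hQ.coeffs_unique (n := l + 1) (a := 1) (a' := 1) (b := r) (c := s)
        (b' := 1 / 2 * (ψ.eval (β (l + 2)) / dCoef φ ψ (l + 1)))
        (c' := -((l + 1) * φ.coeff 2 / dCoef φ ψ l) * γ (l + 2))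
        (by simpa [prev] using h5.symm.trans h4)
      exact ⟨h6.2.1, h6.2.2 (by omega)⟩
    · rintro ⟨rfl, rfl⟩
      exact h4
  constructor
  · intro H n hn
    exact (key n hn _ _).mp (H n hn)
  · intro H n hn
    exact (key n hn _ _).mpr (H n hn)

end

/-! ### From the derivative relation to the distributional equation -/

theorem degree_lt_of_degree_derivative_lt {q : ℂ[X]} {m : ℕ} (h : (derivative q).degree < m) :
    q.degree < ((m + 1 : ℕ) : WithBot ℕ) := by
  by_contra hq
  have h1 : m + 1 ≤ q.natDegree := le_natDegree_of_coe_le_degree (not_lt.mp hq)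
  rw [degree_derivative (by omega)] at h
  have h2 : q.natDegree - 1 < m := by exact_mod_cast h
  omega

theorem degree_lt_of_iterate_derivative_eq_zero {j : ℕ} :
    ∀ {q : ℂ[X]}, derivative^[j] q = 0 → q.degree < j := by
  induction j with
  | zero => intro q h; rw [Function.iterate_zero_apply] at h; rw [h]; simp
  | succ j ih =>
    intro q h
    rw [Function.iterate_succ_apply] at h
    exact degree_lt_of_degree_derivative_lt (ih h)

section

variable (hP : IsMonicOP u P)
include hP

/-- A functional that vanishes at almost all `P n` is a polynomial multiple of `u`. -/
theorem IsMonicOP.eq_mulF {K : ℕ} (hv : ∀ i, K ≤ i → v (P i) = 0) :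
    v = mulF (∑ i ∈ Finset.range K, C (v (P i) / u (P i * P i)) * P i) u := by
  refine hP.functional_ext fun n => ?_
  rw [mulF_apply, Finset.sum_mul, map_sum]
  simp only [mul_assoc, map_C_mul]
  rcases lt_or_ge n K with hn | hn
  · rw [Finset.sum_eq_single n]
    · rw [div_mul_cancel₀ _ (hP.norm_ne_zero n)]
    · intro b _ hb
      rw [hP.apply_mul_ne hb, mul_zero]
    · intro h
      exact absurd (Finset.mem_range.mpr hn) h
  · rw [hv n hn, Finset.sum_eq_zero]
    intro i hi
    rw [hP.apply_mul_ne (show i ≠ n by have := Finset.mem_range.mp hi; omega), mul_zero]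

theorem IsMonicOP.fourier {K : ℕ} {p : ℂ[X]} (hp : p.degree < K) :
    p = ∑ i ∈ Finset.range K, C (u (P i * p) / u (P i * P i)) * P i := by
  have h := hP.eq_mulF (v := mulF p u) (K := K) fun i hi => by
    rw [mulF_apply, mul_comm]
    exact hP.apply_mul_of_degree_lt (hp.trans_le (by exact_mod_cast hi))
  have := hP.mulF_injective h
  simpa only [mulF_apply, mul_comm p] using this

/-- Modulo `g ≠ 0` the tails `P i` (`i ≥ k`) still span everything: a functional that annihilates
them and the multiples of `g` is `q u` with `g q = 0`. -/
theorem IsMonicOP.span_mk_eq_top {g : ℂ[X]} (hg : g ≠ 0) (k : ℕ) :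
    Submodule.span ℂ ((fun i => AdjoinRoot.mkₐ g (P i)) '' Set.Ici k) = ⊤ := by
  by_contra hne
  obtain ⟨f, hf0, hf⟩ := Submodule.exists_le_ker_of_lt_top _ (lt_top_iff_ne_top.mpr hne)
  let L : Functional := f ∘ₗ (AdjoinRoot.mkₐ g).toLinearMap
  have hL : ∀ i, k ≤ i → L (P i) = 0 := fun i hi =>
    hf (Submodule.subset_span ⟨i, hi, rfl⟩)
  have h1 := hP.eq_mulF hL
  set q := ∑ i ∈ Finset.range k, C (L (P i) / u (P i * P i)) * P i
  have h2 : g * q = 0 := by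
    refine hP.eq_zero_of_mulF (LinearMap.ext fun p => ?_)
    have h3 := congrArg (fun w : Functional => w (g * p)) h1
    have h4 : L (g * p) = 0 := by
      change f (AdjoinRoot.mk g (g * p)) = 0
      rw [map_mul, AdjoinRoot.mk_self, zero_mul, map_zero]
    simp only [h4, mulF_apply] at h3
    rw [mulF_apply, LinearMap.zero_apply, h3]
    congr 1
    ring
  have h5 : q = 0 := (mul_eq_zero.mp h2).resolve_left hg
  apply hf0
  refine LinearMap.ext fun x => ?_
  obtain ⟨p, rfl⟩ := AdjoinRoot.mk_surjective x
  have h6 := congrArg (fun w : Functional => w p) h1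
  simpa [h5, L] using h6

/-- If for every large `M` some multiple of `g` lies in the span of `P M, …, P (M + j)` and
involves `P M`, then modulo `g` the spans of `j` consecutive terms increase; they exhaust the
quotient by `g`, whose dimension `deg g` is therefore at most `j`. -/
theorem IsMonicOP.natDegree_le_of_dvd {g : ℂ[X]} (hg : g ≠ 0) (k j : ℕ)
    (h : ∀ M, k ≤ M → ∃ p, g ∣ p ∧ p.natDegree ≤ M + j ∧ (∀ i < M, u (P i * p) = 0) ∧
      u (P M * p) ≠ 0) : g.natDegree ≤ j := by
  let π := fun i => AdjoinRoot.mkₐ g (P i)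
  let U : ℕ → Submodule ℂ (AdjoinRoot g) := fun M =>
    Submodule.span ℂ (π '' Finset.Ico (k + M) (k + M + j))
  have hmono : Monotone U := by
    refine monotone_nat_of_le_succ fun M => Submodule.span_le.mpr ?_
    rintro _ ⟨i, hi, rfl⟩
    rw [Finset.coe_Ico, Set.mem_Ico] at hi
    have hmem : ∀ i, k + M < i → i ≤ k + M + j → π i ∈ U (M + 1) := fun i h1 h2 =>
      Submodule.subset_span ⟨i, by rw [Finset.coe_Ico, Set.mem_Ico]; omega, rfl⟩
    rcases hi.1.eq_or_lt with rfl | h1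
    · obtain ⟨p, hgp, hd, h0, hM⟩ := h (k + M) (by omega)
      have h2 := hP.fourier (K := k + M + j + 1) (p := p)
        (degree_le_natDegree.trans_lt (by exact_mod_cast (by omega)))
      have h3 := congrArg (AdjoinRoot.mkₐ g) h2
      have h4 : AdjoinRoot.mkₐ g p = 0 := AdjoinRoot.mk_eq_zero.mpr hgp
      simp only [← smul_eq_C_mul, map_sum, map_smul] at h3
      rw [h4, ← Finset.add_sum_erase _ _
        (Finset.mem_range.mpr (show k + M < k + M + j + 1 by omega))] at h3
      have h5 := Submodule.sum_mem (U (M + 1)) (t := (Finset.range (k + M + j + 1)).erase (k + M))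
        (f := fun i => (u (P i * p) / u (P i * P i)) • π i) (fun i hi => by
          rw [Finset.mem_erase, Finset.mem_range] at hi
          rcases lt_or_ge i (k + M) with h6 | h6
          · rw [h0 i h6, zero_div, zero_smul]; exact Submodule.zero_mem _
          · exact Submodule.smul_mem _ _ (hmem i (by omega) (by omega)))
      have h6 := eq_neg_of_add_eq_zero_left h3.symm
      have h7 : (u (P (k + M) * p) / u (P (k + M) * P (k + M))) • π (k + M) ∈ U (M + 1) := by
        rw [show (u (P (k + M) * p) / u (P (k + M) * P (k + M))) • π (k + M) = _ from h6]
        exact Submodule.neg_mem _ h5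
      exact (Submodule.smul_mem_iff _ (div_ne_zero hM (hP.norm_ne_zero _))).mp h7
    · exact hmem i h1 (by omega)
  have : FiniteDimensional ℂ (AdjoinRoot g) := (AdjoinRoot.powerBasis hg).finite
  obtain ⟨n, hn⟩ := monotone_stabilizes_iff_noetherian.mpr
    (inferInstance : IsNoetherian ℂ (AdjoinRoot g)) ⟨U, hmono⟩
  have hn : ∀ m, n ≤ m → U n = U m := hn
  rcases Nat.eq_zero_or_pos j with rfl | hj
  · -- all tails vanish modulo `g`, so the quotient is trivial
    have h1 := hP.span_mk_eq_top hg k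
    have h2 : Submodule.span ℂ ((fun i => AdjoinRoot.mkₐ g (P i)) '' Set.Ici k) = ⊥ := by
      rw [Submodule.span_eq_bot]
      rintro _ ⟨i, hi, rfl⟩
      obtain ⟨p, hgp, hd, h0, hM⟩ := h i hi
      have h2 := hP.fourier (K := i + 1) (p := p)
        (degree_le_natDegree.trans_lt (by exact_mod_cast (by omega)))
      rw [Finset.sum_range_succ, Finset.sum_eq_zero, zero_add] at h2
      · rw [h2] at hgp
        have h3 : IsUnit (C (u (P i * p) / u (P i * P i))) :=
          (div_ne_zero hM (hP.norm_ne_zero _)).isUnit.map C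
        exact AdjoinRoot.mk_eq_zero.mpr ((h3.dvd_mul_left).mp hgp)
      · intro l hl
        rw [h0 l (Finset.mem_range.mp hl)]; simp
    have h3 : (⊤ : Submodule ℂ (AdjoinRoot g)) = ⊥ := h1.symm.trans h2
    have h4 := finrank_top ℂ (AdjoinRoot g)
    rw [h3, finrank_bot, (AdjoinRoot.powerBasis hg).finrank, AdjoinRoot.powerBasis_dim] at h4
    omega
  have htop : U n = ⊤ := by
    rw [eq_top_iff, ← hP.span_mk_eq_top hg k]
    refine Submodule.span_le.mpr ?_
    rintro _ ⟨i, hi, rfl⟩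
    have hi : k ≤ i := hi
    have h1 : π i ∈ U (i - k) :=
      Submodule.subset_span ⟨i, by rw [Finset.coe_Ico, Set.mem_Ico]; omega, rfl⟩
    have h2 := hmono (le_max_left (i - k) n) h1
    rwa [← hn _ (le_max_right _ _)] at h2
  have hcard : Module.finrank ℂ (U n) ≤ j := by
    classical
    have h1 : U n = Submodule.span ℂ
        (((Finset.Ico (k + n) (k + n + j)).image π : Finset (AdjoinRoot g)) :
          Set (AdjoinRoot g)) := by
      rw [Finset.coe_image]
    rw [h1]
    refine (finrank_span_finset_le_card _).trans (Finset.card_image_le.trans ?_)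
    simp
  rw [htop, finrank_top, (AdjoinRoot.powerBasis hg).finrank, AdjoinRoot.powerBasis_dim] at hcard
  exact hcard

/-- Dually to the derivative relation, the functional `κ` with `D κ = -P (M + 1) u` vanishes at
all `P i` but `P M`, `P (M + 1)`, `P (M + 2)`. -/
theorem DerivRelation.exists_derivF_eq {k : ℕ} {r s : ℕ → ℂ} (h : DerivRelation P (k + 1) r s)
    (M : ℕ) (hM : k ≤ M) : ∃ p : ℂ[X], p.natDegree ≤ M + 2 ∧ (∀ i < M, u (P i * p) = 0) ∧
      u (P M * p) ≠ 0 ∧ derivF (mulF p u) = mulF (-P (M + 1)) u := by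
  obtain ⟨J, hJ⟩ := LinearMap.exists_rightInverse_of_surjective
    (derivative : ℂ[X] →ₗ[ℂ] ℂ[X]) (LinearMap.range_eq_top.mpr derivative_surjective)
  have hJ : ∀ p, derivative (J p) = p := fun p => LinearMap.congr_fun hJ p
  -- `κ` pairs `P (M + 1) u` with an antiderivative
  let κ : Functional := mulF (P (M + 1)) u ∘ₗ J
  have hκ : ∀ p, κ p = u (P (M + 1) * J p) := fun p => rfl
  have hlt : ∀ p : ℂ[X], p.degree < M → κ p = 0 := fun p hp =>
    hP.apply_mul_of_degree_lt (degree_lt_of_degree_derivative_lt (by rwa [hJ]))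
  have hder : ∀ p, κ (derivative p) = u (P (M + 1) * p) := by
    intro p
    have h1 : derivative (J (derivative p) - p) = 0 := by rw [derivative_sub, hJ, sub_self]
    have h2 := eq_C_of_derivative_eq_zero h1
    rw [hκ, ← sub_eq_zero, ← map_sub, ← mul_sub, h2, mul_comm, map_C_mul,
      hP.apply_self (by omega), mul_zero]
  have hbig : ∀ m, M + 3 ≤ m → κ (P m) = 0 := by
    intro m hm
    obtain ⟨l, rfl⟩ : ∃ l, m = l + 2 + k := ⟨m - k - 2, by omega⟩
    have h1 := h (l + 2) (by omega)
    simp only [Nat.add_sub_cancel, show l + 2 - 1 = l + 1 from rfl, normDeriv,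
      Function.iterate_succ_apply, ← iterate_derivative_C_mul, ← iterate_map_add] at h1
    rw [← sub_eq_zero, ← iterate_derivative_sub] at h1
    have h2 := hlt _ ((degree_lt_of_iterate_derivative_eq_zero h1).trans_le (by exact_mod_cast hM))
    simp only [map_sub, map_add, map_C_mul, hder] at h2
    rw [hP.apply_mul_ne (show M + 1 ≠ l + 2 + (k + 1) by omega),
      hP.apply_mul_ne (show M + 1 ≠ l + 1 + (k + 1) by omega),
      hP.apply_mul_ne (show M + 1 ≠ l + (k + 1) by omega)] at h2
    have h3 : ((l + 2 + 1).ascFactorial k : ℂ) ≠ 0 := by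
      exact_mod_cast (Nat.ascFactorial_pos (l + 2) k).ne'
    simpa [h3] using h2
  have hself : κ (P M) ≠ 0 := by
    intro h0
    have h1 := normDeriv_monic_degree hP.degree_eq hP.monic 1 M
    have h2 : (normDeriv P 1 M - P M).degree < M := by
      have := degree_sub_lt_left (p := normDeriv P 1 M) (q := P M) (by rw [h1.1, hP.degree_eq])
        h1.2.ne_zero (by rw [h1.2.leadingCoeff, (hP.monic M).leadingCoeff])
      rwa [h1.1] at this
    have h3 := hlt _ h2
    rw [map_sub, h0, normDeriv_succ, normDeriv_zero, map_C_mul, hder, sub_zero] at h3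
    rcases mul_eq_zero.mp h3 with h4 | h4
    · exact inv_ne_zero (Nat.cast_add_one_ne_zero M) h4
    · exact hP.norm_ne_zero _ h4
  have h1 := hP.eq_mulF hbig
  set p := ∑ i ∈ Finset.range (M + 3), C (κ (P i) / u (P i * P i)) * P i with hp
  have h2 : ∀ i, u (P i * p) = κ (P i) := fun i => by rw [h1, mulF_apply, mul_comm]
  refine ⟨p, ?_, fun i hi => ?_, ?_, ?_⟩
  · refine natDegree_sum_le_of_forall_le _ _ fun i hi => (natDegree_C_mul_le _ _).trans ?_
    rw [hP.natDegree_eq]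
    have := Finset.mem_range.mp hi
    omega
  · rw [h2]
    exact hlt _ (by rw [hP.degree_eq]; exact_mod_cast hi)
  · rwa [h2]
  · rw [← h1]
    refine LinearMap.ext fun q => ?_
    rw [derivF_apply, hder, mulF_apply, neg_mul, map_neg]

end

/-- The polynomials `f` for which `D(f u)` is again a polynomial multiple of `u`. -/
def pearsonIdeal (u : Functional) : Ideal ℂ[X] where
  carrier := {f | ∃ w, Pearson u f w}
  zero_mem' := ⟨0, by simp [pearson_iff]⟩
  add_mem' := by
    rintro f g ⟨w, hw⟩ ⟨z, hz⟩
    refine ⟨w + z, pearson_iff.mpr fun q => ?_⟩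
    rw [add_mul, add_mul, add_add_add_comm, map_add, pearson_iff.mp hw, pearson_iff.mp hz,
      add_zero]
  smul_mem' := by
    rintro c f ⟨w, hw⟩
    refine ⟨c * w + derivative c * f, pearson_iff.mpr fun q => ?_⟩
    have h1 : c • f * derivative q + (c * w + derivative c * f) * q =
        f * derivative (c * q) + w * (c * q) := by
      rw [derivative_mul, smul_eq_mul]; ring
    rw [h1, pearson_iff.mp hw (c * q)]

theorem mem_pearsonIdeal {f : ℂ[X]} : f ∈ pearsonIdeal u ↔ ∃ w, Pearson u f w := Iff.rfl

theorem DerivRelation.isClassicalWith (hP : IsMonicOP u P) {k : ℕ} {r s : ℕ → ℂ}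
    (h : DerivRelation P (k + 1) r s) : ∃ φ ψ, IsClassicalWith u φ ψ := by
  have hΦ := fun M hM => h.exists_derivF_eq hP M hM
  set g := Submodule.IsPrincipal.generator (pearsonIdeal u) with hgdef
  have hdvd : ∀ {f w : ℂ[X]}, Pearson u f w → g ∣ f := fun hf =>
    (Submodule.IsPrincipal.mem_iff_generator_dvd _).mp (mem_pearsonIdeal.mpr ⟨_, hf⟩)
  obtain ⟨ψ, hψ⟩ := mem_pearsonIdeal.mp (Submodule.IsPrincipal.generator_mem (pearsonIdeal u))
  rw [← hgdef] at hψ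
  have hg : g ≠ 0 := by
    rintro h0
    obtain ⟨p, -, -, h2, h3⟩ := hΦ k le_rfl
    have h4 := hdvd h3
    rw [h0, zero_dvd_iff] at h4
    rw [h4] at h2
    simp at h2
  have hg2 : g.natDegree ≤ 2 := hP.natDegree_le_of_dvd hg k 2 fun M hM => by
    obtain ⟨p, h1, h2, h3, h4⟩ := hΦ M hM
    exact ⟨p, hdvd h4, h1, h2, h3⟩
  have hψ1 : ψ.natDegree ≤ 1 := by
    by_contra hs
    -- the degrees of the polynomials `p` drop, so that the bound on `deg g` improves
    have hdeg : ∀ M, k ≤ M → ∃ p, g ∣ p ∧ p.natDegree + 1 ≤ M + g.natDegree ∧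
        (∀ i < M, u (P i * p) = 0) ∧ u (P M * p) ≠ 0 := by
      intro M hM
      obtain ⟨p, h1, h2, h3, h4⟩ := hΦ M hM
      obtain ⟨f, rfl⟩ := hdvd h4
      refine ⟨g * f, dvd_mul_right _ _, ?_, h2, h3⟩
      -- `g f' + ψ f = -P (M + 1)`, and here `ψ f` has the larger degree
      have hf : f ≠ 0 := by rintro rfl; simp at h3
      have hψ0 : ψ ≠ 0 := by rintro rfl; simp at hs
      have h5 : derivF (mulF (g * f) u) = mulF (g * derivative f + ψ * f) u := by
        refine LinearMap.ext fun q => ?_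
        have h6 := pearson_iff.mp hψ (f * q)
        have h7 : g * derivative (f * q) + ψ * (f * q) =
            g * f * derivative q + (g * derivative f + ψ * f) * q := by
          rw [derivative_mul]; ring
        rw [h7, map_add] at h6
        rw [derivF_apply, mulF_apply, mulF_apply]
        exact neg_eq_of_add_eq_zero_right h6
      have h6 := congrArg natDegree (hP.mulF_injective (h5.symm.trans h4))
      have h7 : (ψ * f).natDegree = ψ.natDegree + f.natDegree := natDegree_mul hψ0 hf
      have h8 : (g * derivative f + ψ * f).natDegree = ψ.natDegree + f.natDegree := by
        rcases Nat.eq_zero_or_pos f.natDegree with h0 | h0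
        · rw [derivative_eq_zero.mpr h0, mul_zero, zero_add, h7]
        · rw [natDegree_add_eq_right_of_natDegree_lt, h7]
          rw [h7]
          have h9 := natDegree_derivative_le f
          refine lt_of_le_of_lt natDegree_mul_le ?_
          omega
      rw [h8, natDegree_neg, hP.natDegree_eq] at h6
      rw [natDegree_mul hg hf]
      omega
    rcases Nat.eq_zero_or_pos g.natDegree with h0 | h0
    · obtain ⟨p, -, h1, -, h3⟩ := hdeg k le_rfl
      refine h3 (hP.apply_mul_of_degree_lt (degree_le_natDegree.trans_lt ?_))
      exact_mod_cast (by omega)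
    · have := hP.natDegree_le_of_dvd hg k (g.natDegree - 1) fun M hM => by
        obtain ⟨p, h1, h2, h3⟩ := hdeg M hM
        exact ⟨p, h1, by omega, h3⟩
      omega
  exact ⟨g, ψ, hg, hψ.right_ne_zero hP hg, natDegree_le_iff_degree_le.mp hg2,
    natDegree_le_iff_degree_le.mp hψ1, hψ⟩

end ClassicalOP

theorem mainTheorem1 (u : Functional) (hu : IsRegular u) (P : ℕ → ℂ[X]) (hP : IsMonicOP u P) :
    -- the equivalent characterizations C1, C1', C2, C3, C3', C4, C4', C5, C6, C7, C8
    List.TFAE [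
      ∃ φ ψ, IsClassicalWith u φ ψ,
      ∃ φ ψ, IsAdmissible φ ψ ∧ Pearson u φ ψ,
      ∃ φ : ℂ[X], φ.degree ≤ 2 ∧ ∃ a b c, StructureRelation P φ a b c,
      ∃ k, 1 ≤ k ∧ ∃ v, IsMonicOP v (normDeriv P k),
      ∀ k, 1 ≤ k → ∃ v, IsMonicOP v (normDeriv P k),
      ∃ k, 1 ≤ k ∧ ∃ r s, DerivRelation P k r s,
      ∀ k, 1 ≤ k → ∃ r s, DerivRelation P k r s,
      ∃ φ ψ l, BochnerODE P φ ψ l,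
      ∃ φ ψ, IsAdmissible φ ψ ∧ StieltjesEq u φ ψ,
      ∃ φ ψ, IsAdmissible φ ψ ∧ ∃ h t, McCarthyRelation P φ ψ h t,
      ∃ φ : ℂ[X], φ.degree ≤ 2 ∧ ∃ k, RodriguesFormula u P φ k] ∧
    -- the polynomials are the same in all properties where they appear
    (∀ φ ψ, List.TFAE [
      IsClassicalWith u φ ψ,
      IsAdmissible φ ψ ∧ Pearson u φ ψ,
      ∃ l, BochnerODE P φ ψ l,
      IsAdmissible φ ψ ∧ StieltjesEq u φ ψ,
      IsAdmissible φ ψ ∧ ∃ h t, McCarthyRelation P φ ψ h t]) ∧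
    (∀ φ : ℂ[X], List.TFAE [
      ∃ ψ, IsClassicalWith u φ ψ,
      φ.degree ≤ 2 ∧ ∃ a b c, StructureRelation P φ a b c,
      φ.degree ≤ 2 ∧ ∃ k, RodriguesFormula u P φ k]) ∧
    -- explicit formulas for all the parameters
    (∀ φ ψ, IsClassicalWith u φ ψ →
      (∀ β γ : ℕ → ℂ, TTRR P β γ ↔
        (β 0 = -(ψ.coeff 0 / ψ.coeff 1) ∧
          ∀ n : ℕ, 1 ≤ n → β n =
            -((dCoef φ ψ (-2) * ψ.coeff 0 + 2 * φ.coeff 1 * n * dCoef φ ψ ((n : ℤ) - 1)) /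
              (dCoef φ ψ (2 * (n : ℤ)) * dCoef φ ψ (2 * (n : ℤ) - 2)))) ∧
        (γ 1 = -(φ.eval (-(ψ.coeff 0 / ψ.coeff 1)) / dCoef φ ψ 1) ∧
          ∀ n : ℕ, 2 ≤ n → γ n =
            -(n * dCoef φ ψ ((n : ℤ) - 2) /
              (dCoef φ ψ (2 * (n : ℤ) - 3) * dCoef φ ψ (2 * (n : ℤ) - 1)) *
              φ.eval (-(eCoef φ ψ ((n : ℤ) - 1) / dCoef φ ψ (2 * (n : ℤ) - 2)))))) ∧
      ∀ β γ : ℕ → ℂ, TTRR P β γ →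
        (∀ a b c : ℕ → ℂ, StructureRelation P φ a b c ↔
          (∀ n : ℕ, a n = n * φ.coeff 2) ∧ (∀ n, b n = -(1 / 2) * ψ.eval (β n)) ∧
            ∀ n : ℕ, 1 ≤ n → c n = -dCoef φ ψ ((n : ℤ) - 1) * γ n) ∧
        (∀ r s : ℕ → ℂ, DerivRelation P 1 r s ↔
          ∀ n : ℕ, 2 ≤ n →
            r n = 1 / 2 * (ψ.eval (β n) / dCoef φ ψ ((n : ℤ) - 1)) ∧
            s n = -(((n : ℂ) - 1) * φ.coeff 2 / dCoef φ ψ ((n : ℤ) - 2)) * γ n) ∧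
        (∀ l : ℕ → ℂ, BochnerODE P φ ψ l ↔ ∀ n : ℕ, l n = -n * dCoef φ ψ ((n : ℤ) - 1)) ∧
        (∀ h t : ℕ → ℂ, McCarthyRelation P φ ψ h t ↔
          ∀ n : ℕ, 1 ≤ n → h n = dCoef φ ψ (2 * (n : ℤ) - 3) ∧
            t n = -dCoef φ ψ (2 * (n : ℤ) - 1) * γ n) ∧
        ∀ k : ℕ → ℂ, RodriguesFormula u P φ k ↔
          ∀ n : ℕ, k n = ∏ i ∈ Finset.range n, (dCoef φ ψ ((n : ℤ) + (i : ℤ) - 1))⁻¹) := by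
  have hC : ∀ φ ψ, IsClassicalWith u φ ψ ↔ IsAdmissible φ ψ ∧ Pearson u φ ψ := fun φ ψ =>
    isClassicalWith_iff_admissible hP
  obtain ⟨β, γ, hT⟩ := hP.exists_ttrr
  have hB : ∀ φ ψ, IsClassicalWith u φ ψ ↔ ∃ l, BochnerODE P φ ψ l := fun φ ψ =>
    ⟨fun h => ⟨_, (h.bochnerODE_iff hP _).mpr fun _ => rfl⟩, fun ⟨_, h⟩ => h.isClassicalWith hP⟩
  have hS : ∀ φ ψ, IsClassicalWith u φ ψ ↔ IsAdmissible φ ψ ∧ StieltjesEq u φ ψ := fun φ ψ => by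
    rw [hC]
    exact and_congr_right fun ha => (stieltjesEq_iff ha.1 ha.2.1).symm
  have hM : ∀ φ ψ, IsClassicalWith u φ ψ ↔
      IsAdmissible φ ψ ∧ ∃ h t, McCarthyRelation P φ ψ h t := fun φ ψ =>
    ⟨fun h => ⟨((hC φ ψ).mp h).1, _, _, h.mcCarthyRelation hP hT⟩,
      fun ⟨ha, _, _, H⟩ => H.isClassicalWith hP ha⟩
  have hA : ∀ φ : ℂ[X], (∃ ψ, IsClassicalWith u φ ψ) ↔
      φ.degree ≤ 2 ∧ ∃ a b c, StructureRelation P φ a b c := fun φ =>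
    ⟨fun ⟨_, h⟩ => ⟨h.2.2.1, _, _, _, (h.structureRelation_iff hP hT _ _ _).mpr
      ⟨fun _ => rfl, fun _ => rfl, fun _ _ => rfl⟩⟩,
      fun ⟨hφ, _, _, _, H⟩ => H.isClassicalWith hP hφ⟩
  have hR : ∀ φ : ℂ[X], (∃ ψ, IsClassicalWith u φ ψ) ↔
      φ.degree ≤ 2 ∧ ∃ k, RodriguesFormula u P φ k := fun φ =>
    ⟨fun ⟨_, h⟩ => ⟨h.2.2.1, _, (h.rodriguesFormula_iff hP _).mpr fun _ => rfl⟩,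
      fun ⟨hφ, _, H⟩ => H.isClassicalWith hP hφ⟩
  refine ⟨?_, fun φ ψ => ?_, fun φ => ?_, fun φ ψ h => ⟨fun β' γ' => ?_, fun β' γ' hT' => ?_⟩⟩
  · tfae_have 1 ↔ 2 := by simp only [hC]
    tfae_have 1 ↔ 3 := by simp only [hA]
    tfae_have 1 → 5 := by
      rintro ⟨φ, ψ, h⟩ k -
      obtain ⟨v, _, hv, _⟩ := h.exists_normDeriv hP k
      exact ⟨v, hv⟩
    tfae_have 5 → 4 := fun H => ⟨1, le_rfl, H 1 le_rfl⟩
    tfae_have 5 → 7 := by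
      intro H k hk
      obtain ⟨k, rfl⟩ := Nat.exists_eq_add_of_le' hk
      obtain ⟨v, hv⟩ := H (k + 1) hk
      exact ⟨_, _, derivRelation_of_isMonicOP hP k hv⟩
    tfae_have 4 → 6 := by
      rintro ⟨k, hk, v, hv⟩
      refine ⟨k, hk, ?_⟩
      obtain ⟨k, rfl⟩ := Nat.exists_eq_add_of_le' hk
      exact ⟨_, _, derivRelation_of_isMonicOP hP k hv⟩
    tfae_have 7 → 6 := fun H => ⟨1, le_rfl, H 1 le_rfl⟩
    tfae_have 6 → 1 := by
      rintro ⟨k, hk, r, s, H⟩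
      obtain ⟨k, rfl⟩ := Nat.exists_eq_add_of_le' hk
      exact H.isClassicalWith hP
    tfae_have 1 ↔ 8 := by simp only [hB]
    tfae_have 1 ↔ 9 := by simp only [hS]
    tfae_have 1 ↔ 10 := by simp only [hM]
    tfae_have 1 ↔ 11 := by simp only [hR]
    tfae_finish
  · tfae_have 1 ↔ 2 := hC φ ψ
    tfae_have 1 ↔ 3 := hB φ ψ
    tfae_have 1 ↔ 4 := hS φ ψ
    tfae_have 1 ↔ 5 := hM φ ψ
    tfae_finish
  · tfae_have 1 ↔ 2 := hA φ
    tfae_have 1 ↔ 3 := hR φ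
    tfae_finish
  · constructor
    · intro hT'
      exact ⟨⟨h.beta_zero hP hT', fun n hn => h.beta_eq hP hT' hn⟩,
        h.gamma_one hP hT', fun n hn => h.gamma_eq hP hT' hn⟩
    · rintro ⟨⟨hβ0, hβ⟩, hγ1, hγ⟩
      refine hT.congr (fun n => ?_) fun n hn => ?_
      · rcases Nat.eq_zero_or_pos n with rfl | hn
        · rw [hβ0, h.beta_zero hP hT]
        · rw [hβ n hn, h.beta_eq hP hT hn]
      · rcases hn.eq_or_lt with rfl | hn
        · rw [hγ1, h.gamma_one hP hT]
        · rw [hγ n hn, h.gamma_eq hP hT hn]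
  · exact ⟨h.structureRelation_iff hP hT', h.derivRelation_one_iff hP hT', h.bochnerODE_iff hP,
      h.mcCarthyRelation_iff hP hT', h.rodriguesFormula_iff hP⟩
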